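/- Let $\mathbf{FI}$ be the category of finite sets and injections and $\mathbf{FB}$ the category of finite sets and bijections. An $\mathbf{FI}$-module (respectively $\mathbf{FB}$-module) is a functor from $\mathbf{FI}$ (respectively $\mathbf{FB}$) to $\mathbb{Z}$-modules. For an $\mathbf{FB}$-module $W$ put $\deg(W)=\min\{d\ge -1 : W_S=0 \text{ for all } |S|>d\}\in\{-1,0,1,\dots\}\cup\{\infty\}$. Let $H_0$ be the functor from $\mathbf{FI}$-modules to $\mathbf{FB}$-modules given by $H_0(V)_S=\operatorname{coker}\bigl(\bigoplus_{T\subsetneq S}V_T\to V_S\bigr)$, let $H_i$ be its $i$-th left derived functor, and put $t_i(V)=\deg(H_i(V))$ and $\operatorname{reg}(V)=\max\{t_i(V)-i : i\ge 1\}\in\{-2,-1,0,1,\dots\}\cup\{\infty\}$. Let $a\ge 0$ and $b\ge 1$ be integers. Then $$\max\bigl\{\operatorname{reg}(V) : V \text{ an } \mathbf{FI}\text{-module with } 0\le t_0(V)\le a,\ 0\le t_1(V)\le b\bigr\}=\begin{cases} a+b-1 & \text{if } a<b,\\ 2b-2 & \text{if } a\ge b.\end{cases}$$ In particular the maximum exists.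 For $b=0$ and every integer $a\ge 0$, the same holds with the condition $0\le t_1(V)\le b$ replaced by $t_1(V)\le b$: $$\max\bigl\{\operatorname{reg}(V) : V \text{ an } \mathbf{FI}\text{-module with } 0\le t_0(V)\le a,\ t_1(V)\le 0\bigr\}=2b-2=-2.$$ -/

import Mathlib

open CategoryTheory CategoryTheory.Limits

universe u

/-- Finite sets, as the objects of the category `FI` of finite sets and injections. -/
structure FI : Type 1 where
  carrier : Type
  [finite : Finite carrier]

/-- Finite sets, as the objects of the category `FB` of finite sets and bijections. -/
structure FB : Type 1 where
  carrier : Type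
  [finite : Finite carrier]

attribute [instance] FI.finite FB.finite

instance : Category.{0} FI where
  Hom S T := S.carrier ↪ T.carrier
  id S := Function.Embedding.refl S.carrier
  comp f g := Function.Embedding.trans f g

instance : Category.{0} FB where
  Hom S T := S.carrier ≃ T.carrier
  id S := Equiv.refl S.carrier
  comp f g := Equiv.trans f g

/-- The inclusion of `FB` in `FI`. -/
def FB.toFI : FB ⥤ FI where
  obj S := ⟨S.carrier⟩
  map σ := Equiv.toEmbedding σ

/-- `FI`-modules: functors from `FI` to `ℤ`-modules, with natural transformations. -/
abbrev FIModule : Type (u + 1) := FI ⥤ ModuleCat.{u} ℤ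

/-- `FB`-modules: functors from `FB` to `ℤ`-modules, with natural transformations. -/
abbrev FBModule : Type (u + 1) := FB ⥤ ModuleCat.{u} ℤ

/-- A subset of a finite set, as an object of `FI`. -/
def FI.sub {S : FI} (T : Set S.carrier) : FI := ⟨T⟩

/-- The inclusion of a subset `T ⊆ S`, as a morphism of `FI`. -/
def FI.incl {S : FI} (T : Set S.carrier) : FI.sub T ⟶ S :=
  (Function.Embedding.subtype (fun x => x ∈ T) : {x // x ∈ T} ↪ S.carrier)

namespace FIModule

/-- The image of `⨁_{T ⊊ S} V_T → V_S`. -/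
def decomposables (V : FIModule.{u}) (S : FI) : Submodule ℤ (V.obj S) :=
  ⨆ (T : Set S.carrier) (_ : T ≠ Set.univ), LinearMap.range (V.map (FI.incl T)).hom

/-- Every non-surjective injection `f : T → S` maps `V_T` into the image of
`⨁_{T ⊊ S} V_T → V_S`. -/
theorem range_map_le_decomposables (V : FIModule.{u}) {T S : FI} (f : T ⟶ S)
    (hf : ¬ Function.Surjective (show T.carrier ↪ S.carrier from f)) :
    LinearMap.range (V.map f).hom ≤ decomposables V S := by
  let f' : T.carrier ↪ S.carrier := f
  have hT : Set.range f' ≠ Set.univ := fun h => hf (Set.range_eq_univ.mp h)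
  let g : T ⟶ FI.sub (S := S) (Set.range f') :=
    (⟨fun x => ⟨f' x, x, rfl⟩, fun x y h => f'.injective (congrArg Subtype.val h)⟩ :
      T.carrier ↪ {y // y ∈ Set.range f'})
  have hfg : f = g ≫ FI.incl (S := S) (Set.range f') := rfl
  have h1 : LinearMap.range (V.map f).hom ≤
      LinearMap.range (V.map (FI.incl (S := S) (Set.range f'))).hom := by
    rw [hfg, V.map_comp, ModuleCat.hom_comp]
    exact LinearMap.range_comp_le_range _ _
  exact h1.trans (le_iSup₂_of_le (Set.range f') hT le_rfl)

theorem decomposables_le_comap_map (V : FIModule.{u}) {S S' : FB} (σ : S ⟶ S') :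
    decomposables V (FB.toFI.obj S) ≤
      (decomposables V (FB.toFI.obj S')).comap (V.map (FB.toFI.map σ)).hom := by
  refine iSup₂_le fun T hT => ?_
  rw [← Submodule.map_le_iff_le_comap, ← LinearMap.range_comp, ← ModuleCat.hom_comp,
    ← V.map_comp]
  refine range_map_le_decomposables V _ fun h => hT ?_
  refine Set.eq_univ_of_forall fun x => ?_
  obtain ⟨y, hy⟩ := h ((show S.carrier ≃ S'.carrier from σ) x)
  have hyx : y.1 = x := (show S.carrier ≃ S'.carrier from σ).injective hy
  exact hyx ▸ y.2

theorem decomposables_le_comap_app {V W : FIModule.{u}} (φ : V ⟶ W) (S : FI) :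
    decomposables V S ≤ (decomposables W S).comap (φ.app S).hom := by
  refine iSup₂_le fun T hT => ?_
  rw [← Submodule.map_le_iff_le_comap, ← LinearMap.range_comp, ← ModuleCat.hom_comp,
    φ.naturality, ModuleCat.hom_comp]
  exact (LinearMap.range_comp_le_range _ _).trans
    (le_iSup₂_of_le (f := fun (T : Set S.carrier) (_ : T ≠ Set.univ) =>
      LinearMap.range (W.map (FI.incl T)).hom) T hT le_rfl)

end FIModule

/-- The functor `H₀` from `FI`-modules to `FB`-modules,
`H₀(V)_S = coker (⨁_{T ⊊ S} V_T → V_S)`. -/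
noncomputable def fiH0 : FIModule.{u} ⥤ FBModule.{u} where
  obj V :=
    { obj := fun S => ModuleCat.of ℤ
        (V.obj (FB.toFI.obj S) ⧸ FIModule.decomposables V (FB.toFI.obj S))
      map := fun σ => ModuleCat.ofHom
        (Submodule.mapQ _ _ (V.map (FB.toFI.map σ)).hom (V.decomposables_le_comap_map σ))
      map_id := fun S => by
        ext x
        induction x using Submodule.Quotient.induction_on with
        | H x => simp
      map_comp := fun σ τ => by
        ext x
        induction x using Submodule.Quotient.induction_on with
        | H x => simp }
  map φ :=
    { app := fun S => ModuleCat.ofHom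
        (Submodule.mapQ _ _ (φ.app (FB.toFI.obj S)).hom
          (FIModule.decomposables_le_comap_app φ _))
      naturality := fun S S' σ => by
        ext x
        induction x using Submodule.Quotient.induction_on with
        | H x => simp [NatTrans.naturality_apply] }
  map_id V := by
    ext S x
    induction x using Submodule.Quotient.induction_on with
    | H x => simp
  map_comp φ ψ := by
    ext S x
    induction x using Submodule.Quotient.induction_on with
    | H x => simp

instance : fiH0.{u}.Additive where
  map_add {V W φ ψ} := by
    ext S x
    induction x using Submodule.Quotient.induction_on with
    | H x =>
      simp [fiH0]
      rfl

namespace FIModule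

/-- The free `FI`-module `T ↦ ℤ[Hom(S, T)]` on one generator in `S`. -/
noncomputable def free (S : FI) : FIModule.{u} where
  obj T := ModuleCat.of ℤ ((S ⟶ T) →₀ ULift.{u} ℤ)
  map f := ModuleCat.ofHom (Finsupp.lmapDomain (ULift.{u} ℤ) ℤ (fun g => g ≫ f))
  map_id T := by
    ext : 1
    refine Finsupp.lhom_ext fun g c => ?_
    simp
  map_comp f f' := by
    ext : 1
    refine Finsupp.lhom_ext fun g c => ?_
    simp [Finsupp.mapDomain_single]

/-- The generator of `free S`. -/
noncomputable def gen (S : FI) : (free.{u} S).obj S :=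
  (Finsupp.single (𝟙 S) ⟨1⟩ : (S ⟶ S) →₀ ULift.{u} ℤ)

theorem single_eq_smul_map_gen {S T : FI} (g : S ⟶ T) (c : ULift.{u} ℤ) :
    (Finsupp.single g c : (S ⟶ T) →₀ ULift.{u} ℤ) =
      c.down • (free.{u} S).map g (gen S) := by
  refine Eq.symm (Eq.trans (congrArg (c.down • ·) (Finsupp.mapDomain_single
    (f := fun h : S ⟶ S => h ≫ g) (a := 𝟙 S) (b := (⟨1⟩ : ULift.{u} ℤ)))) ?_)
  rw [Category.id_comp]
  refine (Finsupp.smul_single c.down g (⟨1⟩ : ULift.{u} ℤ)).trans (congrArg _ ?_)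
  ext
  simp

/-- The linear map `ℤ[Hom(S, T)] → V_T`, `g ↦ V(g)(v)`. -/
noncomputable def freeDescApp {S : FI} {V : FIModule.{u}} (v : V.obj S) (T : FI) :
    ((S ⟶ T) →₀ ULift.{u} ℤ) →ₗ[ℤ] V.obj T :=
  Finsupp.lsum ℕ fun g : S ⟶ T =>
    (LinearMap.toSpanSingleton ℤ (V.obj T) (V.map g v)).comp
      (ULift.moduleEquiv : ULift.{u} ℤ ≃ₗ[ℤ] ℤ).toLinearMap

theorem freeDescApp_single {S : FI} {V : FIModule.{u}} (v : V.obj S) {T : FI} (g : S ⟶ T)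
    (c : ULift.{u} ℤ) : freeDescApp v T (Finsupp.single g c) = c.down • V.map g v :=
  (Finsupp.lsum_single ℕ (fun g : S ⟶ T =>
    (LinearMap.toSpanSingleton ℤ (V.obj T) (V.map g v)).comp
      (ULift.moduleEquiv : ULift.{u} ℤ ≃ₗ[ℤ] ℤ).toLinearMap) g c).trans
    (int_smul_eq_zsmul _ c.down (V.map g v))

/-- The map `free S ⟶ V` that sends the generator to `v`. -/
noncomputable def freeDesc {S : FI} {V : FIModule.{u}} (v : V.obj S) : free S ⟶ V where
  app T := ModuleCat.ofHom (freeDescApp v T)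
  naturality T T' f := by
    ext : 1
    refine Finsupp.lhom_ext fun g c => ?_
    change freeDescApp v T' (Finsupp.mapDomain (fun h => h ≫ f) (Finsupp.single g c)) =
      V.map f (freeDescApp v T (Finsupp.single g c))
    rw [Finsupp.mapDomain_single, freeDescApp_single, freeDescApp_single, V.map_comp,
      map_zsmul, ModuleCat.comp_apply]

theorem freeDesc_gen {S : FI} {V : FIModule.{u}} (v : V.obj S) :
    (freeDesc v).app S (gen S) = v := by
  refine (freeDescApp_single v (𝟙 S) ⟨1⟩).trans ?_
  rw [V.map_id, one_smul, ModuleCat.id_apply]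

theorem free_hom_ext {S : FI} {V : FIModule.{u}} {φ ψ : free S ⟶ V}
    (h : φ.app S (gen S) = ψ.app S (gen S)) : φ = ψ := by
  have key : ∀ (χ : free S ⟶ V) (T : FI) (g : S ⟶ T) (c : ULift.{u} ℤ),
      χ.app T (c.down • (free.{u} S).map g (gen S)) = c.down • V.map g (χ.app S (gen S)) := by
    intro χ T g c
    rw [map_zsmul, NatTrans.naturality_apply]
  ext T : 3
  refine Finsupp.lhom_ext fun g c => ?_
  rw [single_eq_smul_map_gen]
  exact (key φ T g c).trans (by rw [h]; exact (key ψ T g c).symm)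

instance (S : FI) : Projective (free.{u} S) where
  factors {E X} f e _ := by
    obtain ⟨w, hw⟩ := (ModuleCat.epi_iff_surjective (e.app S)).mp inferInstance
      (f.app S (gen S))
    refine ⟨freeDesc w, free_hom_ext ?_⟩
    rw [NatTrans.comp_app, ModuleCat.comp_apply, freeDesc_gen, hw]

instance : EnoughProjectives FIModule.{u} where
  presentation V := by
    let F : (Σ n : ℕ, V.obj ⟨Fin n⟩) → FIModule.{u} := fun i => free ⟨Fin i.1⟩
    let p : ∐ F ⟶ V := Limits.Sigma.desc fun i => freeDesc i.2
    have hp : ∀ T : FI, Epi (p.app T) := by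
      intro T
      rw [ModuleCat.epi_iff_surjective]
      intro v
      obtain ⟨n, ⟨e⟩⟩ := Finite.exists_equiv_fin T.carrier
      let g : T ⟶ (⟨Fin n⟩ : FI) := e.toEmbedding
      let g' : (⟨Fin n⟩ : FI) ⟶ T := e.symm.toEmbedding
      have hg : g ≫ g' = 𝟙 T := by
        apply Function.Embedding.ext
        exact e.symm_apply_apply
      let i : Σ n : ℕ, V.obj ⟨Fin n⟩ := ⟨n, V.map g v⟩
      refine ⟨(Limits.Sigma.ι F i).app T ((free ⟨Fin n⟩).map g' (gen ⟨Fin n⟩)), ?_⟩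
      have h1 : Limits.Sigma.ι F i ≫ p = freeDesc (V.map g v) := Limits.Sigma.ι_desc _ _
      rw [← ModuleCat.comp_apply, ← NatTrans.comp_app, h1]
      refine (NatTrans.naturality_apply (freeDesc (V.map g v)) g' (gen ⟨Fin n⟩)).trans ?_
      rw [freeDesc_gen, ← ModuleCat.comp_apply, ← V.map_comp, hg]
      simp
    have hF : ∀ i, Projective (F i) := fun i =>
      inferInstanceAs (Projective (free ⟨Fin i.1⟩))
    have hP : Projective (∐ F) :=
      { factors := fun f e _ =>
          ⟨Limits.Sigma.desc fun i => Projective.factorThru (Limits.Sigma.ι F i ≫ f) e,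
            Limits.Sigma.hom_ext _ _ fun i => by simp⟩ }
    exact ⟨{ p := ∐ F, projective := hP, f := p, epi := NatTrans.epi_of_epi_app p }⟩

/-- `FI`-homology: `Hᵢ` is the `i`-th left derived functor of `H₀`. -/
noncomputable def homology (i : ℕ) : FIModule.{u} ⥤ FBModule.{u} :=
  fiH0.leftDerived i

end FIModule

/-- The degree `min {d ≥ -1 : W_S = 0 for |S| > d}` of an `FB`-module `W`, an element of
`{-1, 0, 1, …} ∪ {∞}`. It is `∞` if there is no such integer `d`. -/
noncomputable def FBModule.deg (W : FBModule.{u}) : EReal :=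
  sInf {x : EReal | ∃ d : ℤ, x = ((d : ℝ) : EReal) ∧ -1 ≤ d ∧
    ∀ S : FB, d < (Nat.card S.carrier : ℤ) → IsZero (W.obj S)}

namespace FIModule

/-- `tᵢ(V) = deg Hᵢ(V)`. -/
noncomputable def t (i : ℕ) (V : FIModule.{u}) : EReal :=
  FBModule.deg ((homology i).obj V)

/-- The regularity `max {tᵢ(V) - i : i ≥ 1}` of `V`, an element of
`{-2, -1, 0, 1, …} ∪ {∞}`. It is `∞` if there is no maximum. -/
noncomputable def reg (V : FIModule.{u}) : EReal :=
  ⨆ (i : ℕ) (_ : 1 ≤ i), (t i V - ((i : ℝ) : EReal))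

end FIModule

/-! Upper bound. Let `deriv V` be the cokernel of `V_S → V_{S ⊔ {*}}`. For a presentation `0 → K → P
→ V → 0` with `P` a sum of free modules, `deriv P` is again projective, and `0 → T → deriv K → deriv
P → deriv V → 0` is exact, where `T` measures the kernel of `V_S → V_{S ⊔ {*}}`. Two facts drive the
argument: `Hᵢ(T)_S` and `Hᵢ₊₁(deriv V)_S` together control `Hᵢ₊₁(V)_{S ⊔ {*}}` (`van_opt`), and the
maps of `T` from proper subsets vanish, so that `H₀(T) = T` (`SES.decomposables_torsion`). If `a <
b`, passing to `deriv V` lowers the bounds on both generators and relations by one. By induction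
`H₂(deriv V)` is bounded, hence so are `T` and, by `van_of_degree`, the homology of `T`. This gives
`van_bound`.

If `a ≥ b`, let `N` be the submodule of `V` generated in degrees `< b`. The quotient `V / N` has `H₁
= 0`, hence no higher homology at all (`van_of_forall_van_one`, by the same induction). So `N`
carries the positive homology of `V`, and the first case for `(b - 1, b)` gives `2b - 2`
(`van_bound_of_relations`).

Sharpness. For `a < b` send a `b`-element subset to the sum of its `a`-element subsets, and take the
cokernel of this map of `FI`-modules. The kernel `Z` is zero on sets with at most `a + b` elements
(inclusion-exclusion) and nonzero on sets with `a + b + 1` elements (counting ranks). Hence `H₀(Z)`,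
and with it `H₂` of the cokernel, is nonzero in degree `a + b + 1`, so the regularity is at least `a
+ b - 1`. For `a ≥ b ≥ 1` the pair `(b - 1, b)` serves; for `b = 0` a free module does.

Homology enters only through the predicate `Van`, and long exact sequences only through their
consequences for vanishing. -/

/-! ### Submodules, quotients and short exact sequences of `FI`-modules. -/

/-- An additive map between `ℤ`-modules, as a morphism of `ModuleCat ℤ`. -/
def ModuleCat.ofAddHom {M N : ModuleCat.{u} ℤ} (f : M →+ N) : M ⟶ N :=
  ModuleCat.ofHom { f with map_smul' := fun n x => map_intCast_smul f ℤ ℤ n x }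

namespace FIModule

/-- A family of submodules that is stable under the structure maps. -/
structure Sub (V : FIModule.{u}) where
  carrier (S : FI) : Submodule ℤ (V.obj S)
  map_mem {S T : FI} (f : S ⟶ T) {x : V.obj S} : x ∈ carrier S → V.map f x ∈ carrier T

namespace Sub

variable {V W : FIModule.{u}}

/-- A submodule, as an `FI`-module. -/
def toModule (N : Sub V) : FIModule.{u} where
  obj S := ModuleCat.of ℤ (N.carrier S)
  map f := ModuleCat.ofAddHom ((V.map f).hom.restrict fun _ hx => N.map_mem f hx).toAddMonoidHom
  map_id S := by
    ext x
    exact (congrArg (fun φ : V.obj S ⟶ V.obj S => φ x.1) (V.map_id S))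
  map_comp f g := by
    ext x
    exact (congrArg (fun φ : V.obj _ ⟶ V.obj _ => φ x.1) (V.map_comp f g))

/-- The inclusion of a submodule. -/
def ι (N : Sub V) : N.toModule ⟶ V where
  app S := ModuleCat.ofAddHom (N.carrier S).subtype.toAddMonoidHom

/-- The quotient by a submodule. -/
def quot (N : Sub V) : FIModule.{u} where
  obj S := ModuleCat.of ℤ (V.obj S ⧸ N.carrier S)
  map f := ModuleCat.ofAddHom
    (Submodule.mapQ _ _ (V.map f).hom fun _ hx => N.map_mem f hx).toAddMonoidHom
  map_id S := by
    ext x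
    induction x using Submodule.Quotient.induction_on with
    | H x => simp; rfl
  map_comp f g := by
    ext x
    induction x using Submodule.Quotient.induction_on with
    | H x => simp; rfl

/-- The projection to the quotient by a submodule. -/
def π (N : Sub V) : V ⟶ N.quot where
  app S := ModuleCat.ofAddHom (N.carrier S).mkQ.toAddMonoidHom

theorem ι_injective (N : Sub V) (S : FI) : Function.Injective (N.ι.app S) :=
  Subtype.val_injective

theorem π_surjective (N : Sub V) (S : FI) : Function.Surjective (N.π.app S) :=
  Submodule.mkQ_surjective _

theorem π_eq_zero_iff (N : Sub V) {S : FI} (x : V.obj S) :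
    N.π.app S x = 0 ↔ x ∈ N.carrier S :=
  Submodule.Quotient.mk_eq_zero _

/-- A morphism into `V` with values in `N`, as a morphism into `N`. -/
def lift (N : Sub V) (φ : W ⟶ V) (h : ∀ S x, φ.app S x ∈ N.carrier S) : W ⟶ N.toModule where
  app S := ModuleCat.ofAddHom ((φ.app S).hom.codRestrict _ (h S)).toAddMonoidHom
  naturality S T f := by
    ext x
    exact Subtype.ext (NatTrans.naturality_apply φ f x)

/-- A morphism that vanishes on `N`, as a morphism from the quotient by `N`. -/
def desc (N : Sub V) (φ : V ⟶ W) (h : ∀ S, ∀ x ∈ N.carrier S, φ.app S x = 0) :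
    N.quot ⟶ W where
  app S := ModuleCat.ofAddHom ((N.carrier S).liftQ (φ.app S).hom (h S)).toAddMonoidHom
  naturality S T f := by
    ext x
    induction x using Submodule.Quotient.induction_on with
    | H x => exact NatTrans.naturality_apply φ f x

end Sub

variable {A B C V W : FIModule.{u}}

/-- The kernel of a morphism. -/
def kernel (φ : V ⟶ W) : Sub V where
  carrier S := LinearMap.ker (φ.app S).hom
  map_mem {S T} f x hx := by
    have hx' : φ.app S x = 0 := hx
    change φ.app T (V.map f x) = 0
    rw [NatTrans.naturality_apply, hx', map_zero]

/-- The image of a morphism. -/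
def range (φ : V ⟶ W) : Sub W where
  carrier S := LinearMap.range (φ.app S).hom
  map_mem {S T} f x hx := by
    obtain ⟨y, rfl⟩ := hx
    exact ⟨V.map f y, NatTrans.naturality_apply φ f y⟩

/-- A short exact sequence of `FI`-modules. -/
structure SES (f : A ⟶ B) (g : B ⟶ C) : Prop where
  inj (S : FI) : Function.Injective (f.app S)
  exact (S : FI) (x : B.obj S) : g.app S x = 0 ↔ ∃ a, f.app S a = x
  surj (S : FI) : Function.Surjective (g.app S)

theorem Sub.ses (N : Sub V) : SES N.ι N.π where
  inj := N.ι_injective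
  exact _ x := (N.π_eq_zero_iff x).trans ⟨fun h => ⟨⟨x, h⟩, rfl⟩, fun ⟨a, ha⟩ => ha ▸ a.2⟩
  surj := N.π_surjective

theorem ses_kernel (φ : V ⟶ W) (h : ∀ S, Function.Surjective (φ.app S)) :
    SES (kernel φ).ι φ where
  inj := (kernel φ).ι_injective
  exact _ x := ⟨fun h => ⟨⟨x, h⟩, rfl⟩, fun ⟨a, ha⟩ => ha ▸ a.2⟩
  surj := h

theorem SES.comp_eq_zero {f : A ⟶ B} {g : B ⟶ C} (h : SES f g) : f ≫ g = 0 := by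
  ext S x
  exact (h.exact S _).mpr ⟨x, rfl⟩

theorem map_mem_decomposables (V : FIModule.{u}) {T S : FI} (f : T ⟶ S)
    (hf : ¬ Function.Surjective (show T.carrier ↪ S.carrier from f)) (x : V.obj T) :
    V.map f x ∈ decomposables V S :=
  range_map_le_decomposables V f hf ⟨x, rfl⟩

theorem decomposables_le {S : FI} {N : Submodule ℤ (V.obj S)}
    (h : ∀ T : Set S.carrier, T ≠ Set.univ → ∀ x, V.map (FI.incl T) x ∈ N) :
    decomposables V S ≤ N :=
  iSup₂_le fun T hT => by
    rintro _ ⟨x, rfl⟩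
    exact h T hT x

theorem map_incl_mem {S : FI} (T : Set S.carrier) (hT : T ≠ Set.univ) (x : V.obj (FI.sub T)) :
    V.map (FI.incl T) x ∈ decomposables V S :=
  map_mem_decomposables V _ (fun h => hT (Set.eq_univ_of_forall fun s => by
    obtain ⟨y, hy⟩ := h s
    exact hy ▸ y.2)) x

theorem app_mem_decomposables (φ : V ⟶ W) {S : FI} {x : V.obj S} (hx : x ∈ decomposables V S) :
    φ.app S x ∈ decomposables W S :=
  decomposables_le_comap_app φ S hx

/-- Elements coming from proper subsets lift there. This is the source of the right exactness of
`H₀`. -/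
theorem exists_mem_decomposables (φ : V ⟶ W) (h : ∀ S, Function.Surjective (φ.app S)) {S : FI}
    {y : W.obj S} (hy : y ∈ decomposables W S) : ∃ x ∈ decomposables V S, φ.app S x = y := by
  have key : decomposables W S ≤ (decomposables V S).map (φ.app S).hom := by
    refine decomposables_le fun T hT x => ?_
    obtain ⟨z, rfl⟩ := h _ x
    exact ⟨V.map (FI.incl T) z, map_incl_mem T hT z, NatTrans.naturality_apply φ _ z⟩
  exact key hy

/-- The map `H₀(φ)_S` is injective. -/
def QInj (φ : V ⟶ W) (S : FI) : Prop :=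
  ∀ x : V.obj S, φ.app S x ∈ decomposables W S → x ∈ decomposables V S

/-- `Hᵢ(V)_S = 0`. -/
def Van (i : ℕ) (V : FIModule.{u}) (S : FI) : Prop :=
  IsZero (((homology i).obj V).obj ⟨S.carrier⟩)

end FIModule

/-! ### Exactness in functor categories, tested objectwise on elements. -/

section FunctorCategory

variable {J : Type*} [Category* J]

theorem isZero_homology_obj_iff (X : ShortComplex (J ⥤ ModuleCat.{u} ℤ)) (j : J) :
    IsZero (X.homology.obj j) ↔
      ∀ x : X.X₂.obj j, X.g.app j x = 0 → ∃ y, X.f.app j y = x := by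
  refine (X.mapHomologyIso ((evaluation J (ModuleCat.{u} ℤ)).obj j)).isZero_iff.symm.trans ?_
  rw [← ShortComplex.exact_iff_isZero_homology, ShortComplex.moduleCat_exact_iff]
  rfl

theorem exact_of_forall_app (X : ShortComplex (J ⥤ ModuleCat.{u} ℤ))
    (h : ∀ j, ∀ x : X.X₂.obj j, X.g.app j x = 0 → ∃ y, X.f.app j y = x) : X.Exact := by
  rw [ShortComplex.exact_iff_isZero_homology, Functor.isZero_iff]
  exact fun j => (isZero_homology_obj_iff X j).mpr (h j)

theorem HomologicalComplex.isZero_homology_obj_iff {ι : Type*} {c : ComplexShape ι}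
    (K : HomologicalComplex (J ⥤ ModuleCat.{u} ℤ) c) (i j k : ι) (hi : c.prev j = i)
    (hk : c.next j = k) (S : J) :
    IsZero ((K.homology j).obj S) ↔
      ∀ x : (K.X j).obj S, (K.d j k).app S x = 0 → ∃ y, (K.d i j).app S y = x := by
  refine (((evaluation J (ModuleCat.{u} ℤ)).obj S).mapIso
    (K.homologyIsoSc' i j k hi hk)).isZero_iff.trans ?_
  exact _root_.isZero_homology_obj_iff (K.sc' i j k) S

end FunctorCategory

/-! ### Right exactness of `H₀` and dimension shifting. -/

namespace FIModule

variable {A B C V W : FIModule.{u}}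

theorem SES.epi {f : A ⟶ B} {g : B ⟶ C} (h : SES f g) : Epi g :=
  (NatTrans.epi_iff_epi_app g).mpr fun S => (ModuleCat.epi_iff_surjective _).mpr (h.surj S)

theorem epi_app_surjective (g : B ⟶ C) [Epi g] (S : FI) : Function.Surjective (g.app S) :=
  (ModuleCat.epi_iff_surjective _).mp ((NatTrans.epi_iff_epi_app g).mp inferInstance S)

/-- The projection `V_S → H₀(V)_S`. -/
def toH0 (V : FIModule.{u}) (S : FB) (x : V.obj (FB.toFI.obj S)) : (fiH0.obj V).obj S :=
  Submodule.Quotient.mk x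

theorem toH0_surjective (V : FIModule.{u}) (S : FB) : Function.Surjective (toH0 V S) :=
  Submodule.Quotient.mk_surjective _

theorem toH0_eq_zero_iff {S : FB} (x : V.obj (FB.toFI.obj S)) :
    toH0 V S x = 0 ↔ x ∈ decomposables V (FB.toFI.obj S) :=
  Submodule.Quotient.mk_eq_zero _

theorem toH0_sub {S : FB} (x y : V.obj (FB.toFI.obj S)) :
    toH0 V S (x - y) = toH0 V S x - toH0 V S y := rfl

theorem map_toH0 (φ : V ⟶ W) {S : FB} (x : V.obj (FB.toFI.obj S)) :
    (fiH0.map φ).app S (toH0 V S x) = toH0 W S (φ.app _ x) := rfl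

theorem mem_range_map_of_map_eq_zero (f : A ⟶ B) (g : B ⟶ C)
    (hfg : ∀ S (x : B.obj S), g.app S x = 0 → ∃ a, f.app S a = x)
    (hg : ∀ S, Function.Surjective (g.app S)) (S : FB) (x : (fiH0.obj B).obj S)
    (hx : (fiH0.map g).app S x = 0) : ∃ y, (fiH0.map f).app S y = x := by
  obtain ⟨b, rfl⟩ := toH0_surjective B S x
  rw [map_toH0, toH0_eq_zero_iff] at hx
  obtain ⟨b', hb', hbb'⟩ := exists_mem_decomposables g hg hx
  obtain ⟨a, ha⟩ := hfg _ (b - b') (by rw [map_sub, hbb', sub_self])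
  refine ⟨toH0 A S a, ?_⟩
  rw [map_toH0, ha, toH0_sub, (toH0_eq_zero_iff b').mpr hb', sub_zero]

instance : PreservesFiniteColimits fiH0.{u} := by
  -- It suffices that short exact sequences go to right exact ones. Right exactness identifies the
  -- zeroth derived functor with `H₀`.
  refine ((Functor.preservesFiniteColimits_tfae fiH0.{u}).out 0 3 :).mp fun X hX => ?_
  have hg : ∀ S, Function.Surjective (X.g.app S) := by
    have := hX.epi_g
    exact epi_app_surjective X.g
  constructor
  · refine exact_of_forall_app _ fun S x hx => ?_
    refine mem_range_map_of_map_eq_zero X.f X.g (fun S x hx => ?_) hg S x hx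
    have := (ShortComplex.exact_iff_isZero_homology X).mp hX.exact
    exact (isZero_homology_obj_iff X S).mp ((Functor.isZero_iff _).mp this S) x hx
  · refine (NatTrans.epi_iff_epi_app _).mpr fun S => (ModuleCat.epi_iff_surjective _).mpr ?_
    intro y
    obtain ⟨y, rfl⟩ := toH0_surjective _ S y
    obtain ⟨x, rfl⟩ := hg _ y
    exact ⟨toH0 _ S x, rfl⟩

theorem isZero_iff_forall_eq_zero (M : ModuleCat.{u} ℤ) : IsZero M ↔ ∀ x : M, x = 0 := by
  rw [ModuleCat.isZero_iff_subsingleton]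
  exact ⟨fun _ x => Subsingleton.elim _ _, fun h => ⟨fun x y => (h x).trans (h y).symm⟩⟩

theorem van_zero_iff {S : FI} : Van 0 V S ↔ ∀ x : V.obj S, x ∈ decomposables V S := by
  have e : ((homology 0).obj V).obj ⟨S.carrier⟩ ≅ (fiH0.obj V).obj ⟨S.carrier⟩ :=
    ((evaluation FB (ModuleCat.{u} ℤ)).obj ⟨S.carrier⟩).mapIso
      (fiH0.leftDerivedZeroIsoSelf.app V)
  rw [Van, e.isZero_iff, isZero_iff_forall_eq_zero]
  exact ⟨fun h x => (toH0_eq_zero_iff (S := ⟨S.carrier⟩) x).mp (h _), fun h x => by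
    obtain ⟨x, rfl⟩ := toH0_surjective V ⟨S.carrier⟩ x
    exact (toH0_eq_zero_iff x).mpr (h x)⟩

section Splice

variable {f : A ⟶ B} {g : B ⟶ C} (h : SES f g) (Q : ProjectiveResolution A)

/-- The augmentation of a projective resolution, as a morphism to the resolved module. -/
noncomputable def augmentation (Q : ProjectiveResolution A) : Q.complex.X 0 ⟶ A := Q.π.f 0

theorem d_augmentation : Q.complex.d 1 0 ≫ augmentation Q = 0 :=
  Q.complex_d_comp_π_f_zero

theorem augmentation_surjective (S : FI) : Function.Surjective ((augmentation Q).app S) := by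
  have : Epi (augmentation Q) := inferInstanceAs (Epi (Q.π.f 0))
  exact epi_app_surjective _ S

theorem exact_augmentation (S : FI) (x : (Q.complex.X 0).obj S)
    (hx : (augmentation Q).app S x = 0) : ∃ y, (Q.complex.d 1 0).app S y = x := by
  have := (ShortComplex.exact_iff_isZero_homology _).mp Q.exact₀
  exact (isZero_homology_obj_iff _ S).mp ((Functor.isZero_iff _).mp this S) x hx

/-- A resolution of `A`, followed by `A → B → C`. -/
noncomputable def spliceComplex (f : A ⟶ B) : ChainComplex FIModule.{u} ℕ :=
  Q.complex.augment (augmentation Q ≫ f) (by rw [← Category.assoc, d_augmentation, zero_comp])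

theorem splice_exactAt {f : A ⟶ B} {g : B ⟶ C} (h : SES f g) (Q : ProjectiveResolution A)
    (n : ℕ) : (spliceComplex Q f).ExactAt (n + 1) := by
  rw [HomologicalComplex.exactAt_iff' _ (n + 2) (n + 1) n (by simp) (by simp)]
  cases n with
  | zero =>
    refine exact_of_forall_app _ fun S (x : (Q.complex.X 0).obj S) hx => ?_
    refine exact_augmentation Q S x (h.inj S ?_)
    rw [map_zero]
    exact hx
  | succ n => exact Q.exact_succ n

/-- The projective resolution of `C` obtained from a projective resolution of `A` and a short
exact sequence `0 → A → B → C → 0` with `B` projective. -/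
noncomputable def splice [Projective B] : ProjectiveResolution C where
  complex := spliceComplex Q f
  projective n := by
    cases n with
    | zero => exact inferInstanceAs (Projective B)
    | succ n => exact Q.projective n
  π := (ChainComplex.toSingle₀Equiv _ _).symm ⟨g, by
    change (augmentation Q ≫ f) ≫ g = 0
    rw [Category.assoc, h.comp_eq_zero, comp_zero]⟩
  quasiIso := ⟨fun n => by
    cases n with
    | zero =>
      have := h.epi
      rw [ChainComplex.quasiIsoAt₀_iff, ShortComplex.quasiIso_iff_of_zeros']
      · refine (ShortComplex.exact_and_epi_g_iff_of_iso
          (S₂ := ShortComplex.mk (augmentation Q ≫ f) g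
            (by rw [Category.assoc, h.comp_eq_zero, comp_zero])) ?_).2 ⟨?_, this⟩
        · exact ShortComplex.isoMk (Iso.refl _) (Iso.refl _) (Iso.refl _)
            ((Category.id_comp _).trans (Category.comp_id _).symm)
            ((Category.id_comp _).trans (Eq.trans
              (ChainComplex.toSingle₀Equiv_symm_apply_f_zero (C := spliceComplex Q f) g _).symm
              (Category.comp_id _).symm))
        · refine exact_of_forall_app _ fun S x hx => ?_
          obtain ⟨a, ha⟩ := (h.exact S x).mp hx
          obtain ⟨y, rfl⟩ := augmentation_surjective Q S a
          exact ⟨y, ha⟩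
      all_goals rfl
    | succ n =>
      rw [quasiIsoAt_iff_exactAt']
      · exact splice_exactAt h Q n
      · exact ChainComplex.exactAt_succ_single_obj _ _⟩

theorem van_iff_resolution (Q : ProjectiveResolution A) (i : ℕ) (S : FI) :
    Van (i + 1) A S ↔ ∀ x : (fiH0.obj (Q.complex.X (i + 1))).obj ⟨S.carrier⟩,
      (fiH0.map (Q.complex.d (i + 1) i)).app ⟨S.carrier⟩ x = 0 →
        ∃ y, (fiH0.map (Q.complex.d (i + 2) (i + 1))).app ⟨S.carrier⟩ y = x := by
  refine (((evaluation FB (ModuleCat.{u} ℤ)).obj ⟨S.carrier⟩).mapIso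
    (Q.isoLeftDerivedObj fiH0 (i + 1))).isZero_iff.trans ?_
  exact HomologicalComplex.isZero_homology_obj_iff
    ((fiH0.mapHomologicalComplex (ComplexShape.down ℕ)).obj Q.complex) (i + 2) (i + 1) i
    (by simp) (by simp) ⟨S.carrier⟩

/-- Dimension shifting. -/
theorem SES.van_add_two_iff {f : A ⟶ B} {g : B ⟶ C} (h : SES f g) [Projective B] (i : ℕ)
    {S : FI} : Van (i + 2) C S ↔ Van (i + 1) A S := by
  let Q := projectiveResolution A
  -- In positive degrees the spliced resolution of `C` is that of `A` moved up by one, so both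
  -- conditions are the same by definition.
  rw [van_iff_resolution (splice h Q), van_iff_resolution Q]
  rfl

/-- `H₁(C)` is the kernel of `H₀(A) → H₀(B)`: the spliced complex reads `H₀(Q₁) → H₀(Q₀) → H₀(B)`,
and the cokernel of its first map is `H₀(A)`. -/
theorem SES.van_one_iff {f : A ⟶ B} {g : B ⟶ C} (h : SES f g) [Projective B] {S : FI} :
    Van 1 C S ↔ QInj f S := by
  let Q := projectiveResolution A
  rw [van_iff_resolution (splice h Q)]
  change (∀ x : (fiH0.obj (Q.complex.X 0)).obj ⟨S.carrier⟩,
    (fiH0.map (augmentation Q ≫ f)).app ⟨S.carrier⟩ x = 0 →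
      ∃ y, (fiH0.map (Q.complex.d 1 0)).app ⟨S.carrier⟩ y = x) ↔ _
  constructor
  · intro H x hx
    obtain ⟨x, rfl⟩ := augmentation_surjective Q S x
    obtain ⟨y, hy⟩ := H (toH0 _ ⟨S.carrier⟩ x)
      ((toH0_eq_zero_iff (S := ⟨S.carrier⟩) _).mpr hx)
    refine (toH0_eq_zero_iff (S := ⟨S.carrier⟩) _).mp ?_
    refine (map_toH0 (augmentation Q) (S := ⟨S.carrier⟩) x).symm.trans ?_
    rw [← hy, ← ModuleCat.comp_apply, ← NatTrans.comp_app, ← fiH0.map_comp,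
      d_augmentation]
    simp
  · intro H x hx
    refine mem_range_map_of_map_eq_zero (Q.complex.d 1 0) (augmentation Q) (exact_augmentation Q)
      (augmentation_surjective Q) ⟨S.carrier⟩ x ?_
    obtain ⟨x, rfl⟩ := toH0_surjective _ _ x
    rw [map_toH0, toH0_eq_zero_iff] at hx ⊢
    exact H _ hx

end Splice

end FIModule

/-! ### Vanishing consequences of the long exact sequence. -/

namespace FIModule

variable {A B C V W : FIModule.{u}}

theorem van_of_projective (V : FIModule.{u}) [Projective V] (i : ℕ) (S : FI) :
    Van (i + 1) V S :=
  (Functor.isZero_iff _).mp (fiH0.isZero_leftDerived_obj_projective_succ i V) _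

theorem van_of_iso {S T : FI} (e : S.carrier ≃ T.carrier) {i : ℕ} (h : Van i V S) :
    Van i V T := by
  let e' : (⟨S.carrier⟩ : FB) ≅ ⟨T.carrier⟩ :=
    { hom := e, inv := e.symm, hom_inv_id := e.self_trans_symm, inv_hom_id := e.symm_trans_self }
  exact h.of_iso (((homology i).obj V).mapIso e').symm

theorem van_zero_of_surjective (φ : V ⟶ W) (h : ∀ S, Function.Surjective (φ.app S)) {S : FI}
    (hV : Van 0 V S) : Van 0 W S := by
  rw [van_zero_iff] at hV ⊢
  intro y
  obtain ⟨x, rfl⟩ := h S y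
  exact app_mem_decomposables φ (hV x)

theorem QInj.comp {φ : A ⟶ B} {ψ : B ⟶ C} {S : FI} (hφ : QInj φ S) (hψ : QInj ψ S) :
    QInj (φ ≫ ψ) S :=
  fun x hx => hφ x (hψ _ hx)

theorem QInj.of_comp {φ : A ⟶ B} {ψ : B ⟶ C} {S : FI} (h : QInj (φ ≫ ψ) S) : QInj φ S :=
  fun x hx => h x (app_mem_decomposables ψ hx)

theorem qInj_of_van {φ : A ⟶ B} {S : FI} (h : Van 0 A S) : QInj φ S :=
  fun x _ => van_zero_iff.mp h x

theorem QInj.van_zero {φ : A ⟶ B} {S : FI} (h : QInj φ S) (hB : Van 0 B S) : Van 0 A S :=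
  van_zero_iff.mpr fun x => h x (van_zero_iff.mp hB _)

theorem exists_projective_presentation (V : FIModule.{u}) :
    ∃ (P : FIModule.{u}) (p : P ⟶ V), Projective P ∧ ∀ S, Function.Surjective (p.app S) := by
  exact ⟨Projective.over V, Projective.π V, inferInstance, epi_app_surjective _⟩

/-- If `P → B` and `B → C` are surjective with kernels `K` of `P → B` and `L` of `P → C`, this is
the map `K → L`. -/
def kernelComp (p : V ⟶ B) (g : B ⟶ C) : (kernel p).toModule ⟶ (kernel (p ≫ g)).toModule :=
  (kernel (p ≫ g)).lift (kernel p).ι fun S x => by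
    have hx : p.app S ((kernel p).ι.app S x) = 0 := x.2
    change g.app S (p.app S ((kernel p).ι.app S x)) = 0
    rw [hx, map_zero]

/-- One cover of `B` also covers `C`, and the two kernels fit into `0 → ker p → ker (p ≫ g) → A →
0`. With a projective cover, this rotated sequence replaces connecting homomorphisms. -/
theorem SES.exists_kernel_desc {f : A ⟶ B} {g : B ⟶ C} (h : SES f g) (p : V ⟶ B)
    (hp : ∀ S, Function.Surjective (p.app S)) :
    ∃ q : (kernel (p ≫ g)).toModule ⟶ A, SES (kernelComp p g) q ∧
      ∀ S x, f.app S (q.app S x) = p.app S ((kernel (p ≫ g)).ι.app S x) := by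
  have key : ∀ S (x : (kernel (p ≫ g)).toModule.obj S),
      ∃ a, f.app S a = p.app S ((kernel (p ≫ g)).ι.app S x) :=
    fun S x => (h.exact S _).mp x.2
  choose q hq using key
  let q' : (kernel (p ≫ g)).toModule ⟶ A :=
    { app := fun S => ModuleCat.ofAddHom
        { toFun := q S
          map_zero' := h.inj S (by rw [hq, map_zero, map_zero, map_zero])
          map_add' := fun x y => h.inj S (by rw [hq, map_add, map_add, map_add, hq, hq]) }
      naturality := fun S T φ => by
        ext x
        refine h.inj T ?_
        change f.app T (q T _) = f.app T (A.map φ (q S x))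
        rw [hq, NatTrans.naturality_apply, hq, ← NatTrans.naturality_apply,
          ← NatTrans.naturality_apply]
        rfl }
  have hq' : ∀ S x, f.app S (q'.app S x) = p.app S ((kernel (p ≫ g)).ι.app S x) := hq
  refine ⟨q', ⟨fun S x y hxy => (kernel p).ι_injective S ?_, fun S x => ?_, fun S a => ?_⟩, hq'⟩
  · exact congrArg ((kernel (p ≫ g)).ι.app S) hxy
  · constructor
    · intro hx
      refine ⟨⟨(kernel (p ≫ g)).ι.app S x, ?_⟩, rfl⟩
      have := hq' S x
      rw [hx, map_zero] at this
      exact this.symm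
    · rintro ⟨y, rfl⟩
      refine h.inj S ?_
      rw [hq', map_zero]
      exact y.2
  · obtain ⟨x, hx⟩ := hp S (f.app S a)
    refine ⟨⟨x, ?_⟩, h.inj S ?_⟩
    · change g.app S (p.app S x) = 0
      rw [hx]
      exact (h.exact S _).mpr ⟨a, rfl⟩
    · exact (hq' _ _).trans hx

/-- `H₁(C) = 0` implies that `H₀(A) → H₀(B)` is injective. -/
theorem SES.qInj {f : A ⟶ B} {g : B ⟶ C} (h : SES f g) {S : FI} (hC : Van 1 C S) :
    QInj f S := by
  obtain ⟨P, p, _, hp⟩ := exists_projective_presentation B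
  obtain ⟨q, -, hq⟩ := h.exists_kernel_desc p hp
  have hpg : ∀ S, Function.Surjective ((p ≫ g).app S) := fun S => (h.surj S).comp (hp S)
  intro a ha
  obtain ⟨x, hx, hxa⟩ := exists_mem_decomposables p hp ha
  have hx0 : (p ≫ g).app S x = 0 := by
    change g.app S (p.app S x) = 0
    rw [hxa]
    exact (h.exact S _).mpr ⟨a, rfl⟩
  have hmem := (ses_kernel (p ≫ g) hpg).van_one_iff.mp hC ⟨x, hx0⟩ hx
  have : q.app S ⟨x, hx0⟩ = a := h.inj S ((hq S _).trans hxa)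
  exact this ▸ app_mem_decomposables q hmem

/-- Right exactness of `H₀`. -/
theorem SES.exists_sub_mem {f : A ⟶ B} {g : B ⟶ C} (h : SES f g) {S : FI} {x : B.obj S}
    (hx : g.app S x ∈ decomposables C S) : ∃ a, x - f.app S a ∈ decomposables B S := by
  obtain ⟨y, hy, hyx⟩ := exists_mem_decomposables g h.surj hx
  obtain ⟨a, ha⟩ := (h.exact S (x - y)).mp (by rw [map_sub, hyx, sub_self])
  exact ⟨a, by rwa [ha, sub_sub_cancel]⟩

theorem SES.van_one_of_qInj {f : A ⟶ B} {g : B ⟶ C} (h : SES f g) {S : FI} (hf : QInj f S)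
    (hB : Van 1 B S) : Van 1 C S := by
  obtain ⟨P, p, _, hp⟩ := exists_projective_presentation B
  obtain ⟨q, hs, hq⟩ := h.exists_kernel_desc p hp
  have hpg : ∀ S, Function.Surjective ((p ≫ g).app S) := fun S => (h.surj S).comp (hp S)
  rw [(ses_kernel (p ≫ g) hpg).van_one_iff]
  rw [(ses_kernel p hp).van_one_iff] at hB
  intro x hx
  have h1 : q.app S x ∈ decomposables A S := hf _ (by
    rw [hq]
    exact app_mem_decomposables p hx)
  obtain ⟨y, hy⟩ := hs.exists_sub_mem h1
  have h2 : (kernel p).ι.app S y ∈ decomposables P S := by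
    have h3 := Submodule.sub_mem _ hx (app_mem_decomposables (kernel (p ≫ g)).ι hy)
    rw [map_sub, sub_sub_cancel] at h3
    exact h3
  have h4 := Submodule.add_mem _ hy (app_mem_decomposables (kernelComp p g) (hB y h2))
  rwa [sub_add_cancel] at h4

theorem SES.van_zero_mid {f : A ⟶ B} {g : B ⟶ C} (h : SES f g) {S : FI} (hA : Van 0 A S)
    (hC : Van 0 C S) : Van 0 B S := by
  rw [van_zero_iff] at *
  intro x
  obtain ⟨a, ha⟩ := h.exists_sub_mem (hC (g.app S x))
  have := Submodule.add_mem _ ha (app_mem_decomposables f (hA a))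
  rwa [sub_add_cancel] at this

theorem SES.van_one_mid {f : A ⟶ B} {g : B ⟶ C} (h : SES f g) {S : FI} (hA : Van 1 A S)
    (hC : Van 1 C S) : Van 1 B S := by
  obtain ⟨P, p, _, hp⟩ := exists_projective_presentation B
  obtain ⟨q, hs, -⟩ := h.exists_kernel_desc p hp
  have hpg : ∀ S, Function.Surjective ((p ≫ g).app S) := fun S => (h.surj S).comp (hp S)
  rw [(ses_kernel (p ≫ g) hpg).van_one_iff] at hC
  rw [(ses_kernel p hp).van_one_iff]
  exact (hs.qInj hA).comp hC

theorem SES.van_one_left {f : A ⟶ B} {g : B ⟶ C} (h : SES f g) {S : FI} (hB : Van 1 B S)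
    (hC : Van 2 C S) : Van 1 A S := by
  obtain ⟨P, p, _, hp⟩ := exists_projective_presentation B
  obtain ⟨q, hs, -⟩ := h.exists_kernel_desc p hp
  have hpg : ∀ S, Function.Surjective ((p ≫ g).app S) := fun S => (h.surj S).comp (hp S)
  rw [(ses_kernel (p ≫ g) hpg).van_add_two_iff 0] at hC
  rw [(ses_kernel p hp).van_one_iff] at hB
  exact hs.van_one_of_qInj (QInj.of_comp (ψ := (kernel (p ≫ g)).ι) hB) hC

/-- The consequences of the long exact sequence for the vanishing of homology. -/
theorem SES.van_aux (i : ℕ) : ∀ {A B C : FIModule.{u}} {f : A ⟶ B} {g : B ⟶ C}, SES f g →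
    ∀ {S : FI}, (Van i A S → Van i C S → Van i B S) ∧
      (Van (i + 1) B S → Van i A S → Van (i + 1) C S) ∧
      (Van (i + 1) C S → Van i B S → Van i A S) := by
  induction i with
  | zero =>
    intro A B C f g h S
    exact ⟨h.van_zero_mid, fun hB hA => h.van_one_of_qInj (qInj_of_van hA) hB,
      fun hC hB => (h.qInj hC).van_zero hB⟩
  | succ i ih =>
    intro A B C f g h S
    obtain ⟨P, p, _, hp⟩ := exists_projective_presentation B
    obtain ⟨q, hs, -⟩ := h.exists_kernel_desc p hp
    have hpg : ∀ S, Function.Surjective ((p ≫ g).app S) := fun S => (h.surj S).comp (hp S)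
    -- Rotation replaces `A, B, C` by `ker p, ker (p ≫ g), A` and lowers the homological degree of
    -- the last two terms, so each of the three claims reduces to another one. Only the cases that
    -- involve `H₁` of the middle or left term need a separate argument.
    have mid : ∀ {A B C : FIModule.{u}} {f : A ⟶ B} {g : B ⟶ C}, SES f g →
        ∀ {S : FI}, Van (i + 1) A S → Van (i + 1) C S → Van (i + 1) B S := by
      intro A B C f g h S hA hC
      cases i with
      | zero => exact h.van_one_mid hA hC
      | succ i =>
        obtain ⟨P, p, _, hp⟩ := exists_projective_presentation B
        obtain ⟨q, hs, -⟩ := h.exists_kernel_desc p hp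
        have hpg : ∀ S, Function.Surjective ((p ≫ g).app S) := fun S => (h.surj S).comp (hp S)
        rw [(ses_kernel p hp).van_add_two_iff]
        rw [(ses_kernel (p ≫ g) hpg).van_add_two_iff] at hC
        exact (ih hs).2.2 hA hC
    refine ⟨mid h, fun hB hA => ?_, fun hC hB => ?_⟩
    · rw [(ses_kernel p hp).van_add_two_iff] at hB
      rw [(ses_kernel (p ≫ g) hpg).van_add_two_iff]
      exact mid hs hB hA
    · cases i with
      | zero => exact h.van_one_left hB hC
      | succ i =>
        rw [(ses_kernel p hp).van_add_two_iff] at hB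
        rw [(ses_kernel (p ≫ g) hpg).van_add_two_iff] at hC
        exact (ih hs).2.1 hC hB

theorem SES.van_mid {f : A ⟶ B} {g : B ⟶ C} (h : SES f g) {i : ℕ} {S : FI} (hA : Van i A S)
    (hC : Van i C S) : Van i B S :=
  (van_aux i h).1 hA hC

theorem SES.van_right {f : A ⟶ B} {g : B ⟶ C} (h : SES f g) {i : ℕ} {S : FI}
    (hB : Van (i + 1) B S) (hA : Van i A S) : Van (i + 1) C S :=
  (van_aux i h).2.1 hB hA

theorem SES.van_left {f : A ⟶ B} {g : B ⟶ C} (h : SES f g) {i : ℕ} {S : FI}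
    (hC : Van (i + 1) C S) (hB : Van i B S) : Van i A S :=
  (van_aux i h).2.2 hC hB

theorem van_of_forall_eq_zero (h : ∀ S (x : V.obj S), x = 0) (i : ℕ) (S : FI) : Van i V S := by
  cases i with
  | zero => exact van_zero_iff.mpr fun x => h S x ▸ Submodule.zero_mem _
  | succ i =>
    have : Projective V := IsZero.projective
      ((Functor.isZero_iff V).mpr fun S => (isZero_iff_forall_eq_zero _).mpr (h S))
    exact van_of_projective V i S

end FIModule

/-! ### Linearizations, sums of free modules and canonical presentations. -/

/-- A functor from `FI` to sets. -/
structure FISet where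
  obj : FI → Type u
  map {S T : FI} : (S ⟶ T) → obj S → obj T
  map_id {S : FI} (y : obj S) : map (𝟙 S) y = y
  map_comp {S T U : FI} (f : S ⟶ T) (g : T ⟶ U) (y : obj S) : map (f ≫ g) y = map g (map f y)

namespace FIModule

variable {A B C V W : FIModule.{u}}

/-- The linearization of a functor from `FI` to sets. -/
noncomputable def lin (Y : FISet.{u}) : FIModule.{u} where
  obj T := ModuleCat.of ℤ (Y.obj T →₀ ℤ)
  map f := ModuleCat.ofAddHom (Finsupp.mapDomain.addMonoidHom (Y.map f))
  map_id T := by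
    ext : 1
    refine LinearMap.toAddMonoidHom_injective (Finsupp.addHom_ext fun y n => ?_)
    change Finsupp.mapDomain (Y.map (𝟙 T)) (Finsupp.single y n) = Finsupp.single y n
    rw [Finsupp.mapDomain_single, Y.map_id]
  map_comp f g := by
    ext : 1
    refine LinearMap.toAddMonoidHom_injective (Finsupp.addHom_ext fun y n => ?_)
    change Finsupp.mapDomain (Y.map (f ≫ g)) (Finsupp.single y n) =
      Finsupp.mapDomain (Y.map g) (Finsupp.mapDomain (Y.map f) (Finsupp.single y n))
    rw [Finsupp.mapDomain_single, Finsupp.mapDomain_single, Finsupp.mapDomain_single, Y.map_comp]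

/-- A basis vector of a linearization. -/
noncomputable def basis (Y : FISet.{u}) {T : FI} (y : Y.obj T) : (lin Y).obj T :=
  (Finsupp.single y 1 : Y.obj T →₀ ℤ)

variable {Y : FISet.{u}}

theorem map_basis {S T : FI} (f : S ⟶ T) (y : Y.obj S) :
    (lin Y).map f (basis Y y) = basis Y (Y.map f y) :=
  Finsupp.mapDomain_single

theorem lin_induction {T : FI} {N : Submodule ℤ ((lin Y).obj T)} (h : ∀ y, basis Y y ∈ N)
    (x : (lin Y).obj T) : x ∈ N := by
  have h0 : ∀ x : Y.obj T →₀ ℤ, (show (lin Y).obj T from x) ∈ N := by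
    intro x
    induction x using Finsupp.induction_linear with
    | zero => exact N.zero_mem
    | add x y hx hy => exact N.add_mem hx hy
    | single y n =>
      have : (Finsupp.single y n : Y.obj T →₀ ℤ) = n • Finsupp.single y 1 := by simp
      rw [this]
      exact zsmul_mem (h y) n
  exact h0 x

theorem lin_map_injective {S T : FI} (f : S ⟶ T) (h : Function.Injective (Y.map f)) :
    Function.Injective ((lin Y).map f) :=
  Finsupp.mapDomain_injective h

/-- The morphism from a linearization with given values on the basis. -/
noncomputable def linDesc (φ : ∀ T, Y.obj T → V.obj T)
    (h : ∀ {S T : FI} (f : S ⟶ T) (y : Y.obj S), φ T (Y.map f y) = V.map f (φ S y)) :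
    lin Y ⟶ V where
  app T := ModuleCat.ofAddHom
    (Finsupp.liftAddHom fun y => zmultiplesHom (V.obj T) (φ T y) : (Y.obj T →₀ ℤ) →+ V.obj T)
  naturality S T f := by
    ext : 1
    refine LinearMap.toAddMonoidHom_injective (Finsupp.addHom_ext fun y n => ?_)
    change Finsupp.liftAddHom (fun y => zmultiplesHom (V.obj T) (φ T y))
        (Finsupp.mapDomain (Y.map f) (Finsupp.single y n)) =
      V.map f (Finsupp.liftAddHom (fun y => zmultiplesHom (V.obj S) (φ S y))
        (Finsupp.single y n))
    rw [Finsupp.mapDomain_single, Finsupp.liftAddHom_apply_single,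
      Finsupp.liftAddHom_apply_single, zmultiplesHom_apply, zmultiplesHom_apply, h, map_zsmul]

theorem linDesc_basis (φ : ∀ T, Y.obj T → V.obj T)
    (h : ∀ {S T : FI} (f : S ⟶ T) (y : Y.obj S), φ T (Y.map f y) = V.map f (φ S y)) {T : FI}
    (y : Y.obj T) : (linDesc φ h).app T (basis Y y) = φ T y :=
  (Finsupp.liftAddHom_apply_single (fun y => zmultiplesHom (V.obj T) (φ T y)) y 1).trans
    (one_zsmul _)

theorem lin_hom_ext {φ ψ : lin Y ⟶ V}
    (h : ∀ T (y : Y.obj T), φ.app T (basis Y y) = ψ.app T (basis Y y)) : φ = ψ := by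
  ext T x
  exact lin_induction (N := LinearMap.eqLocus (φ.app T).hom (ψ.app T).hom) (h T) x

/-- A disjoint union of representable functors. -/
def repr {ι : Type u} (X : ι → FI) : FISet.{u} where
  obj T := Σ i, (X i ⟶ T)
  map f y := ⟨y.1, y.2 ≫ f⟩
  map_id y := by rw [Category.comp_id]
  map_comp f g y := by rw [Category.assoc]

theorem repr_map_injective {ι : Type u} (X : ι → FI) {S T : FI} (f : S ⟶ T) :
    Function.Injective ((repr X).map f) := by
  rintro ⟨i, g⟩ ⟨j, h⟩ hgh
  obtain rfl : i = j := congrArg Sigma.fst hgh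
  have h1 : g ≫ f = h ≫ f := eq_of_heq (Sigma.mk.inj hgh).2
  have h2 : g = h := Function.Embedding.ext fun x =>
    Function.Embedding.injective (show S.carrier ↪ T.carrier from f)
      (congrArg (fun k : X i ⟶ T => (show (X i).carrier ↪ T.carrier from k) x) h1)
  rw [h2]

/-- A basis vector of a sum of free modules. -/
noncomputable def single {ι : Type u} {X : ι → FI} {T : FI} (i : ι) (g : X i ⟶ T) :
    (lin (repr X)).obj T :=
  basis (repr X) ⟨i, g⟩

section Repr

variable {ι : Type u} {X : ι → FI}

theorem map_single {S T : FI} (f : S ⟶ T) (i : ι) (g : X i ⟶ S) :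
    (lin (repr X)).map f (single i g) = single i (g ≫ f) :=
  map_basis f _

theorem single_eq_map {T : FI} (i : ι) (g : X i ⟶ T) :
    single i g = (lin (repr X)).map g (single i (𝟙 (X i))) := by
  rw [map_single, Category.id_comp]

theorem repr_induction {T : FI} {N : Submodule ℤ ((lin (repr X)).obj T)}
    (h : ∀ i (g : X i ⟶ T), single i g ∈ N) (x : (lin (repr X)).obj T) : x ∈ N :=
  lin_induction (Y := repr X) (fun y => h y.1 y.2) x

theorem repr_hom_ext {φ ψ : lin (repr X) ⟶ V}
    (h : ∀ T i (g : X i ⟶ T), φ.app T (single i g) = ψ.app T (single i g)) : φ = ψ :=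
  lin_hom_ext (Y := repr X) fun T y => h T y.1 y.2

/-- The morphism from a sum of free modules with given values on the generators. -/
noncomputable def reprDesc (v : ∀ i, V.obj (X i)) : lin (repr X) ⟶ V :=
  linDesc (Y := repr X) (fun _ y => V.map y.2 (v y.1)) fun f y =>
    congrArg (fun φ => φ (v y.1)) (V.map_comp y.2 f)

theorem reprDesc_single (v : ∀ i, V.obj (X i)) {T : FI} (i : ι) (g : X i ⟶ T) :
    (reprDesc v).app T (single i g) = V.map g (v i) :=
  linDesc_basis (Y := repr X) (fun _ y => V.map y.2 (v y.1))
    (fun f y => congrArg (fun φ => φ (v y.1)) (V.map_comp y.2 f)) _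

instance projective_lin_repr : Projective (lin (repr X)) where
  factors {E B} f e _ := by
    choose w hw using fun i => epi_app_surjective e (X i) (f.app (X i) (single i (𝟙 (X i))))
    refine ⟨reprDesc w, repr_hom_ext fun T i g => ?_⟩
    rw [NatTrans.comp_app, ModuleCat.comp_apply, reprDesc_single, NatTrans.naturality_apply, hw,
      ← NatTrans.naturality_apply, ← single_eq_map]

theorem single_mem_decomposables {T : FI} (i : ι) (g : X i ⟶ T)
    (h : Nat.card T.carrier ≠ Nat.card (X i).carrier) :
    single i g ∈ decomposables (lin (repr X)) T := by
  rw [single_eq_map]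
  refine map_mem_decomposables _ _ (fun hs => h ?_) _
  exact (Nat.card_congr (Equiv.ofBijective _
    ⟨(show (X i).carrier ↪ T.carrier from g).injective, hs⟩)).symm

end Repr

/-- The generators in degrees satisfying `p` of the canonical presentation. -/
abbrev presIndex (p : ℕ → Prop) (V : FIModule.{u}) : Type u :=
  Σ n : {n // p n}, V.obj ⟨Fin n⟩

/-- The degrees of the generators of the canonical presentation. -/
abbrev presGen (p : ℕ → Prop) (V : FIModule.{u}) (i : presIndex p V) : FI := ⟨Fin i.1⟩

/-- The sum of free modules on all elements of `V` in degrees satisfying `p`. -/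
noncomputable abbrev pres (p : ℕ → Prop) (V : FIModule.{u}) : FIModule.{u} :=
  lin (repr (presGen p V))

/-- The canonical morphism `pres p V → V`. -/
noncomputable def presπ (p : ℕ → Prop) (V : FIModule.{u}) : pres p V ⟶ V :=
  reprDesc fun i => i.2

theorem pres_map_injective (p : ℕ → Prop) (V : FIModule.{u}) {S T : FI} (f : S ⟶ T) :
    Function.Injective ((pres p V).map f) :=
  lin_map_injective f (repr_map_injective _ f)

theorem van_zero_pres {p : ℕ → Prop} {S : FI} (h : ¬ p (Nat.card S.carrier)) :
    Van 0 (pres p V) S := by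
  refine van_zero_iff.mpr (repr_induction fun i g =>
    single_mem_decomposables (X := presGen p V) i g fun hi => h ?_)
  rw [hi, Nat.card_fin]
  exact i.1.2

theorem pres_eq_zero {p : ℕ → Prop} {S : FI} (h : ∀ n ≤ Nat.card S.carrier, ¬ p n)
    (x : (pres p V).obj S) : x = 0 := by
  refine (Submodule.mem_bot ℤ).mp (repr_induction (N := ⊥) (fun i g => ?_) x)
  refine (h _ ?_ i.1.2).elim
  have := Nat.card_le_card_of_injective _ (show Fin i.1 ↪ S.carrier from g).injective
  rwa [Nat.card_fin] at this

theorem presπ_surjective_of {p : ℕ → Prop} {S : FI} (h : p (Nat.card S.carrier)) :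
    Function.Surjective ((presπ p V).app S) := by
  intro x
  let e : S.carrier ≃ Fin (Nat.card S.carrier) := Finite.equivFin S.carrier
  let n : {n // p n} := ⟨Nat.card S.carrier, h⟩
  let f : S ⟶ (⟨Fin n⟩ : FI) := e.toEmbedding
  let g : (⟨Fin n⟩ : FI) ⟶ S := e.symm.toEmbedding
  let i : presIndex p V := ⟨n, V.map f x⟩
  refine ⟨single (X := presGen p V) i g, ?_⟩
  refine (reprDesc_single (X := presGen p V) (fun i => i.2)
    i g).trans ?_
  change V.map g (V.map f x) = x
  rw [← ModuleCat.comp_apply, ← V.map_comp]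
  have : f ≫ g = 𝟙 S := Function.Embedding.ext e.symm_apply_apply
  rw [this, V.map_id]
  rfl

/-- Nakayama's lemma, by induction on the cardinality: decomposable elements come from smaller sets.
-/
theorem presπ_surjective {p : ℕ → Prop}
    (h : ∀ S : FI, ¬ p (Nat.card S.carrier) → Van 0 V S) (S : FI) :
    Function.Surjective ((presπ p V).app S) := by
  induction hn : Nat.card S.carrier using Nat.strong_induction_on generalizing S with
  | _ n ih =>
    by_cases hp : p (Nat.card S.carrier)
    · exact presπ_surjective_of hp
    · have key : decomposables V S ≤ LinearMap.range ((presπ p V).app S).hom := by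
        refine decomposables_le fun T hT x => ?_
        have hlt : Nat.card (FI.sub T).carrier < n := by
          rw [← hn]
          exact Set.ncard_lt_card hT
        obtain ⟨y, rfl⟩ := ih _ hlt _ rfl x
        exact ⟨_, NatTrans.naturality_apply (presπ p V) (FI.incl T) y⟩
      exact fun x => key (van_zero_iff.mp (h S hp) x)

theorem ses_pres {p : ℕ → Prop} (h : ∀ S : FI, ¬ p (Nat.card S.carrier) → Van 0 V S) :
    SES (kernel (presπ p V)).ι (presπ p V) :=
  ses_kernel _ (presπ_surjective h)

end FIModule

/-! ### Adjoining a point; the shift and the derivative. -/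

/-- The set `S ⊔ {*}`. -/
def FI.opt (S : FI) : FI := ⟨Option S.carrier⟩

/-- The injection `S ⊔ {*} → T ⊔ {*}` induced by an injection `S → T`. -/
def FI.optMap {S T : FI} (f : S ⟶ T) : S.opt ⟶ T.opt :=
  Function.Embedding.optionMap (show S.carrier ↪ T.carrier from f)

/-- The inclusion of `S` in `S ⊔ {*}`. -/
def FI.optι (S : FI) : S ⟶ S.opt :=
  (Function.Embedding.some : S.carrier ↪ Option S.carrier)

/-- The functor `S ↦ S ⊔ {*}`. -/
def FI.optFunctor : FI ⥤ FI where
  obj := FI.opt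
  map := FI.optMap
  map_id S := Function.Embedding.ext fun x => by cases x <;> rfl
  map_comp f g := Function.Embedding.ext fun x => by cases x <;> rfl

theorem FI.optι_naturality {S T : FI} (f : S ⟶ T) : f ≫ T.optι = S.optι ≫ FI.optMap f := rfl

theorem FI.card_opt (S : FI) : Nat.card S.opt.carrier = Nat.card S.carrier + 1 :=
  Finite.card_option

/-- The injection `S ⊔ {*} → T` that extends `f` by `* ↦ t`. -/
noncomputable def FI.extend {S T : FI} (f : S ⟶ T) (t : T.carrier)
    (ht : ∀ s, (show S.carrier ↪ T.carrier from f) s ≠ t) : S.opt ⟶ T :=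
  (⟨fun x => x.elim t (show S.carrier ↪ T.carrier from f), by
    rintro (_ | x) (_ | y) h
    · rfl
    · exact (ht y h.symm).elim
    · exact (ht x h).elim
    · exact congrArg some ((show S.carrier ↪ T.carrier from f).injective h)⟩ :
    Option S.carrier ↪ T.carrier)

theorem FI.optι_extend {S T : FI} (f : S ⟶ T) (t : T.carrier)
    (ht : ∀ s, (show S.carrier ↪ T.carrier from f) s ≠ t) : S.optι ≫ FI.extend f t ht = f := rfl

theorem FI.exists_optι_comp {S T : FI} (h : S ⟶ T.opt)
    (hh : ∀ s, (show S.carrier ↪ Option T.carrier from h) s ≠ none) :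
    ∃ g : S ⟶ T, h = g ≫ T.optι := by
  choose g hg using fun s => Option.ne_none_iff_exists.mp (hh s)
  refine ⟨(⟨g, fun x y hxy => ?_⟩ : S.carrier ↪ T.carrier), ?_⟩
  · refine (show S.carrier ↪ Option T.carrier from h).injective ?_
    rw [← hg, ← hg, hxy]
  · exact Function.Embedding.ext fun s => (hg s).symm

/-- The complement of an element. -/
def FI.erase (S : FI) (s : S.carrier) : FI := FI.sub (S := S) {x | x ≠ s}

open Classical in
/-- The bijection `S → (S ∖ {s}) ⊔ {*}` that sends `s` to `*`. -/
noncomputable def FI.toOptErase (S : FI) (s : S.carrier) : S ⟶ (S.erase s).opt :=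
  (⟨fun x => if h : x = s then none else some ⟨x, h⟩, fun x y hxy => by
    dsimp only at hxy
    split_ifs at hxy with hx hy hy
    · rw [hx, hy]
    · exact congrArg Subtype.val (Option.some.inj hxy)⟩ :
    S.carrier ↪ Option {x // x ∈ {x | x ≠ s}})

theorem FI.toOptErase_self (S : FI) (s : S.carrier) :
    (show S.carrier ↪ Option {x // x ∈ {x | x ≠ s}} from S.toOptErase s) s = none :=
  dif_pos rfl

theorem FI.toOptErase_of_ne (S : FI) {s x : S.carrier} (hx : x ≠ s) :
    (show S.carrier ↪ Option {x // x ∈ {x | x ≠ s}} from S.toOptErase s) x = some ⟨x, hx⟩ :=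
  dif_neg hx

theorem FI.exists_toOptErase_comp {S T : FI} (h : S ⟶ T.opt) (s : S.carrier)
    (hs : (show S.carrier ↪ Option T.carrier from h) s = none) :
    ∃ g : S.erase s ⟶ T, h = S.toOptErase s ≫ FI.optMap g := by
  let h' : S.carrier ↪ Option T.carrier := h
  have hne : ∀ x : {x // x ∈ {x | x ≠ s}}, h' x ≠ none :=
    fun x hx => x.2 (h'.injective (hx.trans hs.symm))
  choose g hg using fun x => Option.ne_none_iff_exists.mp (hne x)
  refine ⟨(⟨g, fun x y hxy => ?_⟩ : {x // x ∈ {x | x ≠ s}} ↪ T.carrier), ?_⟩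
  · refine Subtype.ext (h'.injective ?_)
    rw [← hg, ← hg, hxy]
  · refine Function.Embedding.ext fun x => ?_
    by_cases hx : x = s
    · rw [hx]
      exact hs.trans (congrArg (Option.map g) (S.toOptErase_self s)).symm
    · exact (hg ⟨x, hx⟩).symm.trans (congrArg (Option.map g) (S.toOptErase_of_ne hx)).symm

theorem FI.toOptErase_comp_injective {S T : FI} (s : S.carrier) {g g' : S.erase s ⟶ T}
    (h : S.toOptErase s ≫ FI.optMap g = S.toOptErase s ≫ FI.optMap g') : g = g' := by
  refine Function.Embedding.ext fun x => ?_
  have h1 := congrArg (fun k : S ⟶ T.opt => (show S.carrier ↪ Option T.carrier from k) x.1) h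
  have h2 := S.toOptErase_of_ne x.2
  change Option.map (show {x // x ∈ {x | x ≠ s}} ↪ T.carrier from g)
      ((show S.carrier ↪ Option {x // x ∈ {x | x ≠ s}} from S.toOptErase s) x.1) =
    Option.map (show {x // x ∈ {x | x ≠ s}} ↪ T.carrier from g')
      ((show S.carrier ↪ Option {x // x ∈ {x | x ≠ s}} from S.toOptErase s) x.1) at h1
  rw [h2] at h1
  exact Option.some.inj h1

namespace FIModule

variable {A B C V W : FIModule.{u}}

/-- The shift `S ↦ V_{S ⊔ {*}}`. -/
abbrev shift (V : FIModule.{u}) : FIModule.{u} := FI.optFunctor ⋙ V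

/-- The morphism from `V` to its shift. -/
def shiftι (V : FIModule.{u}) : V ⟶ shift V where
  app S := V.map S.optι
  naturality S T f := by
    change V.map f ≫ V.map T.optι = V.map S.optι ≫ V.map (FI.optMap f)
    rw [← V.map_comp, ← V.map_comp, FI.optι_naturality]

/-- The derivative of `V`, the cokernel of the morphism from `V` to its shift. -/
def deriv (V : FIModule.{u}) : FIModule.{u} := (range (shiftι V)).quot

/-- The projection `V_{S ⊔ {*}} → (deriv V)_S`. -/
def toDeriv (V : FIModule.{u}) (S : FI) : V.obj S.opt →+ (deriv V).obj S :=
  ((range (shiftι V)).π.app S).hom.toAddMonoidHom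

theorem toDeriv_surjective (V : FIModule.{u}) (S : FI) : Function.Surjective (toDeriv V S) :=
  (range (shiftι V)).π_surjective S

theorem toDeriv_eq_zero_iff {S : FI} (x : V.obj S.opt) :
    toDeriv V S x = 0 ↔ ∃ y, V.map S.optι y = x :=
  (range (shiftι V)).π_eq_zero_iff (S := S) x

theorem toDeriv_map_optι {S : FI} (y : V.obj S) : toDeriv V S (V.map S.optι y) = 0 :=
  (toDeriv_eq_zero_iff _).mpr ⟨y, rfl⟩

theorem map_toDeriv {S T : FI} (f : S ⟶ T) (x : V.obj S.opt) :
    (deriv V).map f (toDeriv V S x) = toDeriv V T (V.map (FI.optMap f) x) :=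
  (NatTrans.naturality_apply (range (shiftι V)).π f x).symm

/-- The functoriality of the derivative. -/
def derivMap (φ : V ⟶ W) : deriv V ⟶ deriv W :=
  (range (shiftι V)).desc (Functor.whiskerLeft FI.optFunctor φ ≫ (range (shiftι W)).π) (by
    rintro S _ ⟨y, rfl⟩
    refine (toDeriv_eq_zero_iff _).mpr ⟨φ.app S y, ?_⟩
    exact (NatTrans.naturality_apply φ S.optι y).symm)

theorem derivMap_toDeriv (φ : V ⟶ W) {S : FI} (x : V.obj S.opt) :
    (derivMap φ).app S (toDeriv V S x) = toDeriv W S (φ.app S.opt x) := rfl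

/-- `H₀(deriv V)_S = H₀(V)_{S ⊔ {*}}`. -/
theorem toDeriv_mem_decomposables_iff {S : FI} (x : V.obj S.opt) :
    toDeriv V S x ∈ decomposables (deriv V) S ↔ x ∈ decomposables V S.opt := by
  constructor
  · have key : ∀ z ∈ decomposables (deriv V) S, ∀ x, toDeriv V S x = z →
        x ∈ decomposables V S.opt := by
      have hι : ∀ y : V.obj S, V.map S.optι y ∈ decomposables V S.opt := fun y =>
        map_mem_decomposables V S.optι (fun h => by
          obtain ⟨s, hs⟩ := h (none : Option S.carrier)
          exact Option.some_ne_none s hs) y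
      let N : Submodule ℤ ((deriv V).obj S) :=
        (decomposables V S.opt).map ((range (shiftι V)).π.app S).hom
      have hN : decomposables (deriv V) S ≤ N := by
        refine decomposables_le fun T hT z => ?_
        obtain ⟨y, rfl⟩ := toDeriv_surjective V _ z
        rw [map_toDeriv]
        refine Submodule.mem_map_of_mem (map_mem_decomposables V _ (fun h => hT ?_) y)
        refine Set.eq_univ_of_forall fun s => ?_
        obtain ⟨t, ht⟩ := h (some s : Option S.carrier)
        cases t with
        | none => exact (Option.some_ne_none s ht.symm).elim
        | some t => exact Option.some.inj ht ▸ t.2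
      intro z hz x hx
      obtain ⟨x', hx', hxx'⟩ : ∃ x' ∈ decomposables V S.opt, toDeriv V S x' = z := hN hz
      obtain ⟨y, hy⟩ := (toDeriv_eq_zero_iff (x - x')).mp
        ((map_sub _ _ _).trans (sub_eq_zero.mpr (hx.trans hxx'.symm)))
      rw [← sub_add_cancel x x', ← hy]
      exact Submodule.add_mem _ (hι y) hx'
    exact fun hx => key _ hx x rfl
  · intro hx
    have key : decomposables V S.opt ≤
        (decomposables (deriv V) S).comap ((range (shiftι V)).π.app S).hom := by
      refine decomposables_le fun T hT y => ?_
      change toDeriv V S (V.map _ y) ∈ decomposables (deriv V) S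
      -- If `* ∈ T`, then `T = T' ⊔ {*}` with `T' ⊊ S`, and the element comes from `(deriv V)_{T'}`.
      -- Otherwise `T ⊆ S`, and it dies in the derivative.
      by_cases hn : none ∈ T
      · let T' : Set S.carrier := {s | some s ∈ T}
        let g : FI.sub T ⟶ (FI.sub T').opt :=
          (⟨fun x => match x with
            | ⟨none, _⟩ => none
            | ⟨some s, hs⟩ => some ⟨s, hs⟩, by
            rintro ⟨_ | x, hx⟩ ⟨_ | y, hy⟩ hxy
            · rfl
            · cases hxy
            · cases hxy
            · exact Subtype.ext (congrArg some (congrArg Subtype.val (Option.some.inj hxy)))⟩ :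
            {x // x ∈ T} ↪ Option {s // s ∈ T'})
        have hfg : FI.incl T = g ≫ FI.optMap (FI.incl T') := by
          refine Function.Embedding.ext ?_
          rintro ⟨_ | x, hx⟩ <;> rfl
        rw [hfg, V.map_comp, ModuleCat.comp_apply, ← map_toDeriv]
        refine map_incl_mem T' (fun h => hT ?_) _
        refine Set.eq_univ_of_forall fun x => ?_
        cases x with
        | none => exact hn
        | some s => exact (h ▸ Set.mem_univ s : s ∈ T')
      · obtain ⟨g, hg⟩ := FI.exists_optι_comp (T := S) (FI.incl T) fun s hs => hn (hs ▸ s.2)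
        rw [hg, V.map_comp, ModuleCat.comp_apply, toDeriv_map_optι]
        exact Submodule.zero_mem _
    exact key hx

theorem van_zero_deriv_iff {S : FI} : Van 0 (deriv V) S ↔ Van 0 V S.opt := by
  rw [van_zero_iff, van_zero_iff]
  refine ⟨fun h x => (toDeriv_mem_decomposables_iff x).mp (h _), fun h z => ?_⟩
  obtain ⟨x, rfl⟩ := toDeriv_surjective V S z
  exact (toDeriv_mem_decomposables_iff x).mpr (h x)

theorem qInj_derivMap_iff {φ : V ⟶ W} {S : FI} : QInj (derivMap φ) S ↔ QInj φ S.opt := by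
  refine ⟨fun h x hx => ?_, fun h z hz => ?_⟩
  · rw [← toDeriv_mem_decomposables_iff] at hx ⊢
    exact h _ hx
  · obtain ⟨x, rfl⟩ := toDeriv_surjective V S z
    rw [derivMap_toDeriv, toDeriv_mem_decomposables_iff] at hz
    exact (toDeriv_mem_decomposables_iff x).mpr (h x hz)

end FIModule

/-! ### The derivative of a sum of free modules is projective. -/

namespace FIModule

variable {A B C V W : FIModule.{u}}

/-- The shift of a functor from `FI` to sets. -/
def _root_.FISet.shift (Y : FISet.{u}) : FISet.{u} where
  obj S := Y.obj S.opt
  map f := Y.map (FI.optMap f)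
  map_id y := (congrArg (fun f => Y.map f y) (FI.optFunctor.map_id _)).trans (Y.map_id y)
  map_comp f g y :=
    (congrArg (fun f => Y.map f y) (FI.optFunctor.map_comp f g)).trans (Y.map_comp _ _ y)

section DerivRepr

variable {ι : Type u} {X : ι → FI}

theorem single_eq_map_toOptErase {T : FI} (i : ι) (s : (X i).carrier)
    (g : (X i).erase s ⟶ T) :
    toDeriv (lin (repr X)) T (single i ((X i).toOptErase s ≫ FI.optMap g)) =
      (deriv (lin (repr X))).map g
        (toDeriv (lin (repr X)) _ (single i ((X i).toOptErase s))) := by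
  rw [map_toDeriv, map_single]

open Classical in
/-- The values on the basis of the morphism `shift (lin (repr X)) → V` that is `v i s` on the
generators sending `s` to `*` and vanishes on those that avoid `*`. -/
noncomputable def derivReprFun (v : ∀ i (s : (X i).carrier), V.obj ((X i).erase s)) (T : FI)
    (y : (repr X).shift.obj T) : V.obj T :=
  if h : ∃ s, (show (X y.1).carrier ↪ Option T.carrier from y.2) s = none then
    V.map (FI.exists_toOptErase_comp y.2 h.choose h.choose_spec).choose (v y.1 h.choose)
  else 0

theorem derivReprFun_of_eq (v : ∀ i (s : (X i).carrier), V.obj ((X i).erase s)) {T : FI} {i : ι}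
    (s : (X i).carrier) (g : (X i).erase s ⟶ T) :
    derivReprFun v T ⟨i, (X i).toOptErase s ≫ FI.optMap g⟩ = V.map g (v i s) := by
  let h : X i ⟶ T.opt := (X i).toOptErase s ≫ FI.optMap g
  have hs : (show (X i).carrier ↪ Option T.carrier from h) s = none :=
    congrArg (Option.map (show {x // x ∈ {x | x ≠ s}} ↪ T.carrier from g))
      ((X i).toOptErase_self s)
  have hex : ∃ s, (show (X i).carrier ↪ Option T.carrier from h) s = none := ⟨s, hs⟩
  have key : ∀ (s' : (X i).carrier)
      (hs' : (show (X i).carrier ↪ Option T.carrier from h) s' = none)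
      (g' : (X i).erase s' ⟶ T), h = (X i).toOptErase s' ≫ FI.optMap g' →
      V.map g' (v i s') = V.map g (v i s) := by
    intro s' hs' g' hg'
    obtain rfl : s' = s :=
      (show (X i).carrier ↪ Option T.carrier from h).injective (hs'.trans hs.symm)
    rw [FI.toOptErase_comp_injective s' hg']
  exact (dif_pos hex).trans (key _ hex.choose_spec _
    (FI.exists_toOptErase_comp h hex.choose hex.choose_spec).choose_spec)

theorem derivReprFun_of_ne (v : ∀ i (s : (X i).carrier), V.obj ((X i).erase s)) {T : FI} {i : ι}
    (h : X i ⟶ T.opt) (hh : ∀ s, (show (X i).carrier ↪ Option T.carrier from h) s ≠ none) :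
    derivReprFun v T ⟨i, h⟩ = 0 :=
  dif_neg fun ⟨s, hs⟩ => hh s hs

theorem derivReprFun_map (v : ∀ i (s : (X i).carrier), V.obj ((X i).erase s)) {S T : FI}
    (f : S ⟶ T) (y : (repr X).shift.obj S) :
    derivReprFun v T ((repr X).shift.map f y) = V.map f (derivReprFun v S y) := by
  obtain ⟨i, h⟩ := y
  by_cases hs : ∃ s, (show (X i).carrier ↪ Option S.carrier from h) s = none
  · obtain ⟨s, hs⟩ := hs
    obtain ⟨g, rfl⟩ := FI.exists_toOptErase_comp h s hs
    rw [derivReprFun_of_eq]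
    have hg : (repr X).shift.map f ⟨i, (X i).toOptErase s ≫ FI.optMap g⟩ =
        ⟨i, (X i).toOptErase s ≫ FI.optMap (g ≫ f)⟩ :=
      congrArg (Sigma.mk i) ((Category.assoc _ _ _).trans
        (congrArg (fun k => (X i).toOptErase s ≫ k) (FI.optFunctor.map_comp g f).symm))
    rw [hg]
    refine (derivReprFun_of_eq v s (g ≫ f)).trans ?_
    rw [V.map_comp, ModuleCat.comp_apply]
  · push Not at hs
    rw [derivReprFun_of_ne v h hs, map_zero]
    refine derivReprFun_of_ne v (h ≫ FI.optMap f) fun s hs' => hs s ?_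
    exact Option.map_eq_none_iff.mp hs'

/-- A morphism from the derivative of a sum of free modules. -/
noncomputable def derivReprDesc (v : ∀ i (s : (X i).carrier), V.obj ((X i).erase s)) :
    deriv (lin (repr X)) ⟶ V :=
  (range (shiftι (lin (repr X)))).desc
    (show shift (lin (repr X)) ⟶ V from linDesc (Y := (repr X).shift) (derivReprFun v)
      (derivReprFun_map v)) (by
    rintro S _ ⟨x, rfl⟩
    refine repr_induction (N := LinearMap.ker (((shiftι (lin (repr X))) ≫
      (show shift (lin (repr X)) ⟶ V from linDesc (Y := (repr X).shift) (derivReprFun v)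
      (derivReprFun_map v))).app S).hom) (fun i g => ?_) x
    change (linDesc (Y := (repr X).shift) (derivReprFun v) (derivReprFun_map v)).app S
      ((lin (repr X)).map S.optι (single i g)) = 0
    rw [map_single]
    refine (linDesc_basis (Y := (repr X).shift) (derivReprFun v) (derivReprFun_map v) _).trans ?_
    exact derivReprFun_of_ne v _ fun s => Option.some_ne_none _)

theorem derivReprDesc_single (v : ∀ i (s : (X i).carrier), V.obj ((X i).erase s)) {T : FI}
    (i : ι) (h : X i ⟶ T.opt) :
    (derivReprDesc v).app T (toDeriv _ T (single i h)) = derivReprFun v T ⟨i, h⟩ :=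
  linDesc_basis (Y := (repr X).shift) (derivReprFun v) (derivReprFun_map v) _

/-- An injection `X → T ⊔ {*}` that hits `*` amounts to the preimage `s` of `*` and an injection `X
∖ {s} → T`. So the derivative of the free module on `X` is the sum over `s` of the free modules on
`X ∖ {s}`. -/
instance projective_deriv_lin_repr : Projective (deriv (lin (repr X))) where
  factors {E B} f e _ := by
    choose w hw using fun i s => epi_app_surjective e ((X i).erase s)
      (f.app _ (toDeriv (lin (repr X)) _ (single i ((X i).toOptErase s))))
    refine ⟨derivReprDesc w, ?_⟩
    ext T z
    obtain ⟨x, rfl⟩ := toDeriv_surjective (lin (repr X)) T z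
    refine repr_induction (N := LinearMap.eqLocus
      (((range (shiftι (lin (repr X)))).π ≫ derivReprDesc w ≫ e).app T).hom
      (((range (shiftι (lin (repr X)))).π ≫ f).app T).hom) (fun i (h : X i ⟶ T.opt) => ?_) x
    change e.app T ((derivReprDesc w).app T (toDeriv _ T (single i h))) =
      f.app T (toDeriv _ T (single i h))
    rw [derivReprDesc_single]
    by_cases hs : ∃ s, (show (X i).carrier ↪ Option T.carrier from h) s = none
    · obtain ⟨s, hs⟩ := hs
      obtain ⟨g, rfl⟩ := FI.exists_toOptErase_comp h s hs
      rw [derivReprFun_of_eq, single_eq_map_toOptErase, NatTrans.naturality_apply, hw,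
        ← NatTrans.naturality_apply]
    · push Not at hs
      rw [derivReprFun_of_ne w h hs, map_zero]
      obtain ⟨g, rfl⟩ := FI.exists_optι_comp h hs
      rw [← map_single, toDeriv_map_optι, map_zero]

end DerivRepr

/-! ### The failure of the derivative to be left exact. -/

section Torsion

variable {f : A ⟶ B} {g : B ⟶ C}

/-- For a short exact sequence `0 → A → B → C → 0`, the kernel of `deriv A → deriv B`. -/
abbrev torsion (f : A ⟶ B) : FIModule.{u} := (kernel (derivMap f)).toModule

theorem derivMap_surjective (g : B ⟶ C) (h : ∀ S, Function.Surjective (g.app S)) (S : FI) :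
    Function.Surjective ((derivMap g).app S) := by
  intro z
  obtain ⟨y, rfl⟩ := toDeriv_surjective C S z
  obtain ⟨x, rfl⟩ := h _ y
  exact ⟨toDeriv B S x, rfl⟩

/-- The map from the derivative of `A` to the kernel of `deriv B → deriv C`. -/
def derivToKernel (h : SES f g) : deriv A ⟶ (kernel (derivMap g)).toModule :=
  (kernel (derivMap g)).lift (derivMap f) fun S z => by
    obtain ⟨x, rfl⟩ := toDeriv_surjective A S z
    change (derivMap g).app S ((derivMap f).app S (toDeriv A S x)) = 0
    rw [derivMap_toDeriv, derivMap_toDeriv, (h.exact _ _).mpr ⟨x, rfl⟩, map_zero]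

/-- Together with `SES.ses_deriv` this cuts `0 → torsion f → deriv A → deriv B → deriv C → 0` into
two short exact sequences. -/
theorem SES.ses_torsion (h : SES f g) :
    SES (kernel (derivMap f)).ι (derivToKernel h) where
  inj := (kernel (derivMap f)).ι_injective
  exact S z := by
    constructor
    · intro hz
      exact ⟨⟨z, congrArg ((kernel (derivMap g)).ι.app S) hz⟩, rfl⟩
    · rintro ⟨a, rfl⟩
      exact Subtype.ext a.2
  surj S z := by
    obtain ⟨z, hz⟩ := z
    obtain ⟨p, rfl⟩ := toDeriv_surjective B S z
    obtain ⟨v, hv⟩ := (toDeriv_eq_zero_iff _).mp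
      ((derivMap_toDeriv g p).symm.trans hz)
    obtain ⟨p0, rfl⟩ := h.surj S v
    obtain ⟨a, ha⟩ := (h.exact _ (p - B.map S.optι p0)).mp (by
      rw [map_sub, NatTrans.naturality_apply, hv, sub_self])
    refine ⟨toDeriv A S a, Subtype.ext ?_⟩
    change toDeriv B S (f.app S.opt a) = toDeriv B S p
    rw [ha, map_sub, toDeriv_map_optι, sub_zero]

theorem SES.ses_deriv (h : SES f g) : SES (kernel (derivMap g)).ι (derivMap g) :=
  ses_kernel _ (derivMap_surjective g h.surj)

/-- The snake lemma on elements: torsion is represented by `g p` in the kernel of `C_S → C_{S ⊔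
{*}}`. By `SES.toDeriv_eq_zero` the class vanishes if `g p = 0`. -/
theorem SES.mem_torsion (h : SES f g) {S : FI} (k : (torsion f).obj S) :
    ∃ (w : A.obj S.opt) (p : B.obj S), (kernel (derivMap f)).ι.app S k = toDeriv A S w ∧
      f.app S.opt w = B.map S.optι p ∧ C.map S.optι (g.app S p) = 0 := by
  obtain ⟨w, hw⟩ := toDeriv_surjective A S k.1
  have hk : (derivMap f).app S (toDeriv A S w) = 0 := by
    rw [hw]
    exact k.2
  obtain ⟨p, hp⟩ := (toDeriv_eq_zero_iff _).mp hk
  refine ⟨w, p, hw.symm, hp.symm, ?_⟩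
  rw [← NatTrans.naturality_apply, hp]
  exact (h.exact _ _).mpr ⟨w, rfl⟩

theorem SES.toDeriv_eq_zero (h : SES f g) {S : FI} {w : A.obj S.opt} {p : B.obj S}
    (hw : f.app S.opt w = B.map S.optι p) (hp : g.app S p = 0) : toDeriv A S w = 0 := by
  obtain ⟨a, rfl⟩ := (h.exact S p).mp hp
  rw [← NatTrans.naturality_apply] at hw
  rw [h.inj _ hw, toDeriv_map_optι]

theorem SES.torsion_eq_zero (h : SES f g) {S : FI}
    (hC : Function.Injective (C.map S.optι)) (k : (torsion f).obj S) : k = 0 := by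
  obtain ⟨w, p, hk, hw, hp⟩ := h.mem_torsion k
  refine (kernel (derivMap f)).ι_injective S ?_
  rw [hk, map_zero]
  exact h.toDeriv_eq_zero hw (hC (hp.trans (map_zero _).symm))

/-- For `T ⊊ S` and `s ∉ T` the inclusion `T → S` factors through `T ⊔ {*}` by `* ↦ s`, so it kills
whatever `T → T ⊔ {*}` kills. Hence torsion equals its own `H₀`, and a bound on its generators
bounds the module itself. -/
theorem SES.decomposables_torsion (h : SES f g) (S : FI) : decomposables (torsion f) S ≤ ⊥ := by
  refine decomposables_le fun T hT k => (Submodule.mem_bot ℤ).mpr ?_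
  obtain ⟨w, p, hk, hw, hp⟩ := h.mem_torsion k
  refine (kernel (derivMap f)).ι_injective S ?_
  rw [NatTrans.naturality_apply, hk, map_zero, map_toDeriv]
  obtain ⟨s, hs⟩ := (Set.ne_univ_iff_exists_notMem T).mp hT
  refine h.toDeriv_eq_zero (p := B.map (FI.incl T) p) ?_ ?_
  · rw [NatTrans.naturality_apply, hw, ← ModuleCat.comp_apply, ← ModuleCat.comp_apply,
      ← B.map_comp, ← B.map_comp, FI.optι_naturality]
  · rw [NatTrans.naturality_apply, ← FI.optι_extend (FI.incl T) s fun x hx => hs (hx ▸ x.2),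
      C.map_comp, ModuleCat.comp_apply, hp, map_zero]

theorem SES.torsion_eq_zero_of_van (h : SES f g) {S : FI} (hv : Van 0 (torsion f) S)
    (k : (torsion f).obj S) : k = 0 :=
  (Submodule.mem_bot ℤ).mp (h.decomposables_torsion S (van_zero_iff.mp hv k))

end Torsion

theorem SES.ses_derivMap {f : A ⟶ B} {g : B ⟶ C} (h : SES f g)
    (hC : ∀ S, Function.Injective (C.map (FI.optι S))) : SES (derivMap f) (derivMap g) where
  inj S := by
    refine (injective_iff_map_eq_zero ((derivMap f).app S).hom).mpr fun z hz => ?_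
    exact congrArg ((kernel (derivMap f)).ι.app S) (h.torsion_eq_zero (hC S) ⟨z, hz⟩)
  exact S z := by
    constructor
    · intro hz
      obtain ⟨y, hy⟩ := h.ses_torsion.surj S ⟨z, hz⟩
      exact ⟨y, congrArg ((kernel (derivMap g)).ι.app S) hy⟩
    · rintro ⟨a, rfl⟩
      exact ((derivToKernel h).app S a).2
  surj := derivMap_surjective g h.surj

/-- The canonical presentation with generators in all degrees. -/
theorem ses_pres_all (V : FIModule.{u}) :
    SES (kernel (presπ (fun _ => True) V)).ι (presπ (fun _ => True) V) :=
  ses_pres fun _ h => (h trivial).elim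

theorem kernel_pres_map_injective (p : ℕ → Prop) (V : FIModule.{u}) {S T : FI} (f : S ⟶ T) :
    Function.Injective ((kernel (presπ p V)).toModule.map f) := by
  intro x y hxy
  refine (kernel (presπ p V)).ι_injective S (pres_map_injective p V f ?_)
  rw [← NatTrans.naturality_apply, hxy, NatTrans.naturality_apply]

/-- Without torsion the derivative of a presentation is again a presentation. Dimension shifting
stays in this class because kernels lie in sums of free modules, whose structure maps are injective.
-/
theorem van_opt_iff (i : ℕ) : ∀ {V : FIModule.{u}}, (∀ S, Function.Injective (V.map (FI.optι S))) →
    ∀ {S : FI}, Van i V S.opt ↔ Van i (deriv V) S := by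
  induction i with
  | zero => exact fun _ {S} => van_zero_deriv_iff.symm
  | succ i ih =>
    intro V hV S
    have h := ses_pres_all V
    cases i with
    | zero => rw [h.van_one_iff, (h.ses_derivMap hV).van_one_iff, qInj_derivMap_iff]
    | succ i =>
      rw [h.van_add_two_iff, (h.ses_derivMap hV).van_add_two_iff]
      exact ih fun S => kernel_pres_map_injective _ _ _

/-- This is exactness of `Hᵢ(torsion)_S → Hᵢ₊₁(V)_{S ⊔ {*}} → Hᵢ₊₁(deriv V)_S` in the middle. -/
theorem van_opt {p : ℕ → Prop} (h : SES (kernel (presπ p V)).ι (presπ p V)) {i : ℕ} {S : FI}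
    (hK : Van i (torsion (kernel (presπ p V)).ι) S) (hD : Van (i + 1) (deriv V) S) :
    Van (i + 1) V S.opt := by
  cases i with
  | zero =>
    rw [h.van_one_iff, ← qInj_derivMap_iff]
    rw [h.ses_deriv.van_one_iff] at hD
    refine QInj.comp (φ := derivToKernel h) (fun x hx => ?_) hD
    obtain ⟨k, hk⟩ := h.ses_torsion.exists_sub_mem hx
    have := Submodule.add_mem _ hk (app_mem_decomposables
      (kernel (derivMap (kernel (presπ p V)).ι)).ι (van_zero_iff.mp hK k))
    rwa [sub_add_cancel] at this
  | succ i =>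
    rw [h.van_add_two_iff, van_opt_iff _ fun S => kernel_pres_map_injective _ _ _]
    rw [h.ses_deriv.van_add_two_iff] at hD
    exact h.ses_torsion.van_mid hK hD

end FIModule

/-! ### Upper bounds on the degrees of the homology. -/

theorem FI.exists_equiv_opt {S : FI} {n : ℕ} (h : Nat.card S.carrier = n + 1) :
    ∃ T : FI, Nat.card T.carrier = n ∧ Nonempty (T.opt.carrier ≃ S.carrier) :=
  ⟨⟨Fin n⟩, Nat.card_fin n,
    ⟨(finSuccEquiv n).symm.trans (Finite.equivFinOfCardEq h).symm⟩⟩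

namespace FIModule

variable {A B C V W : FIModule.{u}}

theorem decomposables_le_bot {S : FI}
    (h : ∀ T : FI, Nat.card T.carrier < Nat.card S.carrier → ∀ x : V.obj T, x = 0) :
    decomposables V S ≤ ⊥ :=
  decomposables_le fun T hT x => by
    rw [h (FI.sub T) (Set.ncard_lt_card hT) x, map_zero]
    exact Submodule.zero_mem _

theorem eq_zero_of_forall_van_zero (h : ∀ S, Van 0 V S) (S : FI) (x : V.obj S) : x = 0 := by
  obtain ⟨y, rfl⟩ := presπ_surjective (p := fun _ => False) (fun S _ => h S) S x
  rw [pres_eq_zero (fun _ _ h => h) y, map_zero]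

/-- `H₁(V)_S = 0` if `V` vanishes on all smaller sets. -/
theorem van_one_of_forall_eq_zero {S : FI}
    (h : ∀ T : FI, Nat.card T.carrier < Nat.card S.carrier → ∀ x : V.obj T, x = 0) :
    Van 1 V S := by
  -- Generators of degree at least `|S|` suffice. The cover then has no nonzero decomposable element
  -- over `S`, so `H₀` of the kernel injects there.
  have hs : SES (kernel (presπ (Nat.card S.carrier ≤ ·) V)).ι
      (presπ (Nat.card S.carrier ≤ ·) V) :=
    ses_pres fun T hT => van_zero_iff.mpr fun x => by
      rw [h T (not_le.mp hT) x]
      exact Submodule.zero_mem _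
  rw [hs.van_one_iff]
  intro x hx
  have h1 := decomposables_le_bot (S := S) (fun T hT => pres_eq_zero fun n hn => by omega) hx
  have h2 : x = 0 := hs.inj S (((Submodule.mem_bot ℤ).mp h1).trans (map_zero _).symm)
  exact h2 ▸ Submodule.zero_mem _

theorem van_of_isEmpty {S : FI} (hS : Nat.card S.carrier = 0) (i : ℕ) :
    ∀ V : FIModule.{u}, Van (i + 1) V S := by
  induction i with
  | zero => exact fun V => van_one_of_forall_eq_zero fun T hT => by omega
  | succ i ih => exact fun V => (ses_pres_all V).van_add_two_iff i |>.mpr (ih _)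

/-- If `V` vanishes in degrees `≥ e`, then `Hᵢ(V)` vanishes in degrees `≥ e + i`. -/
theorem van_of_degree (n : ℕ) : ∀ {V : FIModule.{u}} {e i : ℕ} {S : FI},
    (∀ T : FI, e ≤ Nat.card T.carrier → ∀ x : V.obj T, x = 0) → Nat.card S.carrier = n →
      e + i ≤ n → Van i V S := by
  induction n with
  | zero =>
    intro V e i S hV hS hi
    obtain rfl : i = 0 := by omega
    exact van_zero_iff.mpr fun x => by
      rw [hV S (by omega) x]
      exact Submodule.zero_mem _
  | succ n ih =>
    intro V e i S hV hS hi
    by_cases he : e = 0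
    · exact van_of_forall_eq_zero (fun T => hV T (by omega)) i S
    obtain ⟨T, hT, ⟨e'⟩⟩ := FI.exists_equiv_opt hS
    cases i with
    | zero =>
      refine van_zero_iff.mpr fun x => ?_
      rw [hV S (by omega) x]
      exact Submodule.zero_mem _
    | succ i =>
      have h := ses_pres_all V
      -- The torsion also vanishes from degree `e` on, and `deriv V` from `e - 1` on. Both are
      -- evaluated on a set with one element fewer, so the induction on `|S|` applies.
      refine van_of_iso e' (van_opt h (ih (e := e) (fun U hU k => ?_) hT (by omega))
        (ih (e := e - 1) (fun U hU z => ?_) hT (by omega)))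
      · exact h.torsion_eq_zero (fun x y _ => (hV U hU x).trans (hV U hU y).symm) k
      · obtain ⟨x, rfl⟩ := toDeriv_surjective V U z
        rw [hV U.opt (by rw [FI.card_opt]; omega) x, map_zero]

/-- The bound on the regularity of an `FI`-module generated in degrees `< a` and with relations
in degrees `< b`, where `a ≤ b`. -/
theorem van_bound (a : ℕ) : ∀ {b : ℕ} {V : FIModule.{u}}, a ≤ b →
    (∀ S : FI, a ≤ Nat.card S.carrier → Van 0 V S) →
    (∀ S : FI, b ≤ Nat.card S.carrier → Van 1 V S) →
    ∀ {i : ℕ} {S : FI}, a + b + (i + 1) ≤ Nat.card S.carrier + 2 → Van (i + 1) V S := by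
  induction a with
  | zero =>
    intro b V _ h0 _ i S _
    exact van_of_forall_eq_zero (eq_zero_of_forall_van_zero fun S => h0 S (Nat.zero_le _)) _ _
  | succ a ih =>
    intro b V hab h0 h1 i S hS
    obtain ⟨b, rfl⟩ : ∃ b', b = b' + 1 := ⟨b - 1, by omega⟩
    obtain ⟨T, hT, ⟨e⟩⟩ := FI.exists_equiv_opt
      (show Nat.card S.carrier = Nat.card S.carrier - 1 + 1 by omega)
    have h := ses_pres (V := V) (p := (· < a + 1)) fun S hS => h0 S (not_lt.mp hS)
    -- In degrees `≥ b + 1` the cover has no generators, because `a ≤ b`. There `H₁(V) = 0` forces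
    -- `H₀` of the kernel to vanish, and the derivative lowers the degree by one.
    have hW : ∀ U : FI, b ≤ Nat.card U.carrier →
        Van 0 (deriv (kernel (presπ (· < a + 1) V)).toModule) U := by
      intro U hU
      have hU' := FI.card_opt U
      exact van_zero_deriv_iff.mpr ((h.van_one_iff.mp (h1 _ (by omega))).van_zero
        (van_zero_pres (by omega)))
    have hI : ∀ U : FI, b ≤ Nat.card U.carrier → Van 1 (deriv V) U := fun U hU =>
      h.ses_deriv.van_one_iff.mpr (qInj_of_van
        (van_zero_of_surjective (derivToKernel h) h.ses_torsion.surj (hW U hU)))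
    have hD : ∀ {i : ℕ} {S : FI}, a + b + (i + 1) ≤ Nat.card S.carrier + 2 →
        Van (i + 1) (deriv V) S :=
      ih (by omega) (fun U hU => van_zero_deriv_iff.mpr (h0 _ (by
        rw [FI.card_opt]
        omega))) hI
    -- Let `I` be the kernel of `deriv P → deriv V`. Then `H₀(torsion)` lies between `H₁(I) =
    -- H₂(deriv V)` and `H₀(deriv K)`; the former vanishes from degree `a + b` on by induction, the
    -- latter from `b` on.
    have hK : ∀ U : FI, a + b ≤ Nat.card U.carrier →
        ∀ k : (torsion (kernel (presπ (· < a + 1) V)).ι).obj U, k = 0 := fun U hU =>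
      h.torsion_eq_zero_of_van (h.ses_torsion.van_left
        ((h.ses_deriv.van_add_two_iff 0).mp (hD (by omega))) (hW U (by omega)))
    exact van_of_iso e (van_opt h (van_of_degree _ hK hT (by omega)) (hD (by omega)))

/-- If `V` is generated in bounded degree and `H₁(V) = 0`, then `Hᵢ(V) = 0` for all `i ≥ 1`. -/
theorem van_of_forall_van_one (a : ℕ) : ∀ {V : FIModule.{u}},
    (∀ S : FI, a ≤ Nat.card S.carrier → Van 0 V S) → (∀ S : FI, Van 1 V S) →
    ∀ (i : ℕ) (S : FI), Van (i + 1) V S := by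
  induction a with
  | zero =>
    intro V h0 _ i S
    exact van_of_forall_eq_zero (eq_zero_of_forall_van_zero fun S => h0 S (Nat.zero_le _)) _ _
  | succ a ih =>
    intro V h0 h1 i S
    cases hn : Nat.card S.carrier with
    | zero => exact van_of_isEmpty hn i V
    | succ n =>
      obtain ⟨T, -, ⟨e⟩⟩ := FI.exists_equiv_opt hn
      have h := ses_pres_all V
      -- `H₁(V) = 0` makes `H₀(deriv K) → H₀(deriv P)` injective.
      have hinj : ∀ U, QInj (derivMap (kernel (presπ (fun _ => True) V)).ι) U := fun U =>
        qInj_derivMap_iff.mpr (h.van_one_iff.mp (h1 U.opt))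
      have hD : ∀ (i : ℕ) (S : FI), Van (i + 1) (deriv V) S := by
        refine ih (fun U hU => van_zero_deriv_iff.mpr (h0 _ (by
          rw [FI.card_opt]
          omega))) fun U => h.ses_deriv.van_one_iff.mpr fun x hx => ?_
        obtain ⟨y, rfl⟩ := h.ses_torsion.surj U x
        exact app_mem_decomposables _ (hinj U y hx)
      -- A torsion element is zero in `deriv P`, hence decomposable in `deriv K`. Since `H₂(deriv V)
      -- = 0`, it is decomposable already in the torsion, and so it is zero.
      have hK : ∀ U, ∀ k : (torsion (kernel (presπ (fun _ => True) V)).ι).obj U, k = 0 := by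
        intro U k
        have hk : (kernel (derivMap (kernel (presπ (fun _ => True) V)).ι)).ι.app U k ∈
            decomposables _ U := by
          refine hinj U _ ?_
          have : (derivMap (kernel (presπ (fun _ => True) V)).ι).app U
            ((kernel (derivMap (kernel (presπ (fun _ => True) V)).ι)).ι.app U k) = 0 := k.2
          rw [this]
          exact Submodule.zero_mem _
        exact (Submodule.mem_bot ℤ).mp (h.decomposables_torsion U
          (h.ses_torsion.qInj ((h.ses_deriv.van_add_two_iff 0).mp (hD 1 U)) k hk))
      exact van_of_iso e (van_opt h (van_of_forall_eq_zero hK i T) (hD i T))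

/-- The bound on the regularity of an `FI`-module generated in bounded degree and with relations
in degrees `≤ b`. -/
theorem van_bound_of_relations {a b : ℕ} (h0 : ∀ S : FI, a ≤ Nat.card S.carrier → Van 0 V S)
    (h1 : ∀ S : FI, b + 1 ≤ Nat.card S.carrier → Van 1 V S) {i : ℕ} {S : FI}
    (hS : 2 * b + i ≤ Nat.card S.carrier) : Van (i + 1) V S := by
  -- The submodule generated in degrees `< b`. Its quotient turns out to be acyclic, so `N` carries
  -- the positive homology of `V`.
  let N : Sub V := range (presπ (· < b) V)
  have hN0 : ∀ S : FI, b ≤ Nat.card S.carrier → Van 0 N.toModule S := fun S hS =>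
    van_zero_of_surjective (N.lift (presπ (· < b) V) fun S x => ⟨x, rfl⟩)
      (by
        rintro S ⟨_, x, rfl⟩
        exact ⟨x, rfl⟩) (van_zero_pres (by omega))
  have hQ : ∀ S : FI, Nat.card S.carrier < b → ∀ x : N.quot.obj S, x = 0 := by
    intro S hS x
    obtain ⟨x, rfl⟩ := N.π_surjective S x
    obtain ⟨y, hy⟩ := presπ_surjective_of (V := V) (p := (· < b)) hS x
    exact (N.π_eq_zero_iff x).mpr ⟨y, hy⟩
  -- Above degree `b`, `H₁` of the quotient lies between `H₁(V) = 0` and `H₀(N) = 0`. Up to degree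
  -- `b` it vanishes because the quotient is zero below `b`.
  have hQ1 : ∀ S : FI, Van 1 N.quot S := by
    intro S
    by_cases hS : b + 1 ≤ Nat.card S.carrier
    · exact N.ses.van_right (h1 S hS) (hN0 S (by omega))
    · exact van_one_of_forall_eq_zero fun T hT => hQ T (by omega)
  have hQ2 : ∀ (i : ℕ) (S : FI), Van (i + 1) N.quot S :=
    van_of_forall_van_one a (fun S hS => van_zero_of_surjective N.π N.π_surjective (h0 S hS)) hQ1
  have hN1 : ∀ S : FI, b + 1 ≤ Nat.card S.carrier → Van 1 N.toModule S := fun S hS =>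
    N.ses.van_left (hQ2 1 S) (h1 S hS)
  exact N.ses.van_mid (van_bound b (Nat.le_succ b) hN0 hN1 (by omega)) (hQ2 i S)

end FIModule

/-! ### Injectivity of inclusion matrices. -/

/-- A function on the `b`-element subsets of a set with at most `a + b` elements, where `a ≤ b`,
is determined by its sums over the supersets of the `a`-element subsets. -/
theorem Finset.eq_zero_of_sum_superset_eq_zero {α : Type*} [Fintype α] [DecidableEq α] {a b : ℕ}
    (hab : a ≤ b) (hα : Fintype.card α ≤ a + b) (F : Finset α → ℤ)
    (hF : ∀ B, B.card ≠ b → F B = 0)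
    (h : ∀ A : Finset α, A.card = a → ∑ B, (if A ⊆ B then F B else 0) = 0) (B : Finset α) :
    F B = 0 := by
  -- The hypothesis descends to smaller `X`: summing over the sets `X ∪ {t}` counts each `B ⊇ X`
  -- exactly `b - |X|` times, and this factor is nonzero because `|X| < a ≤ b`.
  have h1 : ∀ m, ∀ X : Finset α, X.card + m = a → ∑ B, (if X ⊆ B then F B else 0) = 0 := by
    intro m
    induction m with
    | zero => exact fun X hX => h X hX
    | succ m ih =>
      intro X hX
      have h2 : ∑ t ∈ Xᶜ, ∑ B, (if insert t X ⊆ B then F B else 0) = 0 :=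
        Finset.sum_eq_zero fun t ht => ih _ (by
          rw [Finset.card_insert_of_notMem (Finset.mem_compl.mp ht)]
          omega)
      rw [Finset.sum_comm] at h2
      have h3 : ∀ B, ∑ t ∈ Xᶜ, (if insert t X ⊆ B then F B else 0) =
          ((b : ℤ) - X.card) * (if X ⊆ B then F B else 0) := by
        intro B
        by_cases hXB : X ⊆ B
        · by_cases hB : B.card = b
          · have h4 : ∀ t ∈ Xᶜ, (if insert t X ⊆ B then F B else 0) =
                if t ∈ B then F B else 0 := by
              intro t _
              simp [Finset.insert_subset_iff, hXB]
            have h5 : (Xᶜ.filter (· ∈ B)) = B \ X := by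
              ext t
              simp [and_comm]
            have h6 := Finset.card_sdiff_add_card_eq_card hXB
            rw [Finset.sum_congr rfl h4, ← Finset.sum_filter, h5, Finset.sum_const, if_pos hXB,
              nsmul_eq_mul, ← hB, ← h6]
            push_cast
            ring
          · simp [hF B hB]
        · have h4 : ∀ t ∈ Xᶜ, (if insert t X ⊆ B then F B else 0) = 0 := by
            intro t _
            simp [Finset.insert_subset_iff, hXB]
          rw [Finset.sum_congr rfl h4, if_neg hXB]
          simp
      rw [Finset.sum_congr rfl fun B _ => h3 B, ← Finset.mul_sum] at h2
      refine (mul_eq_zero.mp h2).resolve_left ?_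
      omega
  by_cases hB : B.card = b
  swap
  · exact hF B hB
  -- Inclusion-exclusion over the subsets `X` of `Bᶜ`, all of size at most `a`, keeps only the
  -- `b`-element sets disjoint from `Bᶜ`, that is, `B` alone.
  have h2 : ∑ X ∈ Bᶜ.powerset, (-1 : ℤ) ^ X.card * ∑ C, (if X ⊆ C then F C else 0) = 0 := by
    refine Finset.sum_eq_zero fun X hX => ?_
    have h3 := Finset.card_le_card (Finset.mem_powerset.mp hX)
    have h4 := Finset.card_compl B
    rw [h1 (a - X.card) X (by omega), mul_zero]
  simp_rw [Finset.mul_sum] at h2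
  rw [Finset.sum_comm] at h2
  have h3 : ∀ C, ∑ X ∈ Bᶜ.powerset, (-1 : ℤ) ^ X.card * (if X ⊆ C then F C else 0) =
      if C = B then F B else 0 := by
    intro C
    have h4 : ∀ X ∈ Bᶜ.powerset, (-1 : ℤ) ^ X.card * (if X ⊆ C then F C else 0) =
        if X ⊆ C then (-1 : ℤ) ^ X.card * F C else 0 := fun X _ => by
      split_ifs <;> simp
    have h5 : (Bᶜ.powerset.filter (· ⊆ C)) = (Bᶜ ∩ C).powerset := by
      ext X
      simp only [Finset.mem_filter, Finset.mem_powerset, Finset.subset_inter_iff]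
    rw [Finset.sum_congr rfl h4, ← Finset.sum_filter, h5, ← Finset.sum_mul,
      Finset.sum_powerset_neg_one_pow_card]
    by_cases hC : C.card = b
    · have h6 : Bᶜ ∩ C = ∅ ↔ C = B := by
        constructor
        · intro h7
          refine Finset.eq_of_subset_of_card_le (fun x hx => ?_) (by omega)
          by_contra hxB
          have : x ∈ Bᶜ ∩ C := Finset.mem_inter.mpr ⟨Finset.mem_compl.mpr hxB, hx⟩
          rw [h7] at this
          exact Finset.notMem_empty x this
        · rintro rfl
          ext x
          simp
      by_cases hCB : C = B
      · rw [if_pos (h6.mpr hCB), if_pos hCB, hCB, one_mul]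
      · rw [if_neg (fun h => hCB (h6.mp h)), if_neg hCB, zero_mul]
    · rw [hF C hC, mul_zero, if_neg]
      rintro rfl
      exact hC hB
  rw [Finset.sum_congr rfl fun C _ => h3 C] at h2
  simpa using h2

/-! ### The `FI`-module of `k`-element subsets. -/

/-- The functor of `k`-element subsets. -/
def subsets (k : ℕ) : FISet.{u} where
  obj T := ULift.{u} {A : Finset T.carrier // A.card = k}
  map {S T} f A := ⟨⟨A.down.1.map (show S.carrier ↪ T.carrier from f),
    (Finset.card_map _).trans A.down.2⟩⟩
  map_id _ := ULift.ext _ _ (Subtype.ext Finset.map_refl)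
  map_comp _ _ _ := ULift.ext _ _ (Subtype.ext (Finset.map_map _ _ _).symm)

namespace subsets

variable {k : ℕ}

theorem ext {T : FI} {A B : (subsets.{u} k).obj T} (h : A.down.1 = B.down.1) : A = B :=
  ULift.ext _ _ (Subtype.ext h)

theorem map_injective {S T : FI} (f : S ⟶ T) : Function.Injective ((subsets.{u} k).map f) :=
  fun _ _ h => ext (Finset.map_injective (show S.carrier ↪ T.carrier from f)
    (congrArg (fun C : (subsets k).obj T => C.down.1) h))

theorem exists_incl {T : FI} (A : (subsets.{u} k).obj T) :
    ∃ A0 : (subsets.{u} k).obj (FI.sub (A.down.1 : Set T.carrier)),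
      (subsets k).map (FI.incl _) A0 = A :=
  ⟨⟨⟨A.down.1.attach, (Finset.card_attach).trans A.down.2⟩⟩, ext Finset.attach_map_val⟩

theorem ne_univ {T : FI} (A : (subsets.{u} k).obj T) (h : k ≠ Nat.card T.carrier) :
    (A.down.1 : Set T.carrier) ≠ Set.univ := fun hA => h (by
  rw [← Nat.card_univ, ← hA]
  exact A.down.2.symm.trans (Set.ncard_coe_finset _).symm)

theorem isEmpty {T : FI} (h : Nat.card T.carrier < k) : IsEmpty ((subsets.{u} k).obj T) :=
  ⟨fun A => by
    have h1 := Nat.card_le_card_of_injective _ (Subtype.val_injective (p := (· ∈ A.down.1)))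
    rw [Nat.card_eq_fintype_card, Fintype.card_coe, A.down.2] at h1
    omega⟩

instance {T : FI} : Finite ((subsets.{u} k).obj T) :=
  inferInstanceAs (Finite (ULift {A : Finset T.carrier // A.card = k}))

end subsets

namespace FIModule

theorem lin_subsets_eq_zero {k : ℕ} {T : FI} (h : Nat.card T.carrier < k)
    (x : (lin (subsets.{u} k)).obj T) : x = 0 :=
  (Submodule.mem_bot ℤ).mp (lin_induction (N := ⊥)
    (fun A => ((subsets.isEmpty h).false A).elim) x)

theorem van_zero_lin_subsets {k : ℕ} {T : FI} (h : k ≠ Nat.card T.carrier) :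
    Van 0 (lin (subsets.{u} k)) T := by
  refine van_zero_iff.mpr (lin_induction fun A => ?_)
  obtain ⟨A0, hA0⟩ := subsets.exists_incl A
  rw [← hA0, ← map_basis]
  exact map_incl_mem _ (subsets.ne_univ A h) _

/-- The free module on a `k`-element set covers this module by `g ↦ im g`. Relations are generated
by differences of injections with the same image `A`; they live over `A`, which is a proper subset
of `T`. -/
theorem van_one_lin_subsets {k : ℕ} {T : FI} (h : k < Nat.card T.carrier) :
    Van 1 (lin (subsets.{u} k)) T := by
  let X : PUnit.{u + 1} → FI := fun _ => ⟨Fin k⟩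
  let v : (subsets.{u} k).obj ⟨Fin k⟩ := ⟨⟨Finset.univ, Finset.card_fin k⟩⟩
  let p : lin (repr X) ⟶ lin (subsets.{u} k) := reprDesc fun _ => basis _ v
  have hp : ∀ {S : FI} (g : X ⟨⟩ ⟶ S), p.app S (single ⟨⟩ g) = basis _ ((subsets k).map g v) :=
    fun g => (reprDesc_single _ _ g).trans (map_basis g v)
  have hex : ∀ {S : FI} (A : (subsets.{u} k).obj S), ∃ g : X ⟨⟩ ⟶ S, (subsets k).map g v = A := by
    intro S A
    let e : Fin k ≃ {x // x ∈ A.down.1} := (Finset.equivFinOfCardEq A.down.2).symm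
    refine ⟨e.toEmbedding.trans (Function.Embedding.subtype _), subsets.ext ?_⟩
    refine Eq.trans (b := ((Finset.univ.map e.toEmbedding).map (Function.Embedding.subtype _)))
      (Finset.map_map _ _ _).symm ?_
    rw [Finset.map_univ_equiv, Finset.univ_eq_attach]
    exact Finset.attach_map_val
  have hps : ∀ S, Function.Surjective (p.app S) := by
    intro S x
    refine lin_induction (N := LinearMap.range (p.app S).hom) (fun A => ?_) x
    obtain ⟨g, rfl⟩ := hex A
    exact ⟨_, hp g⟩
  have hs := ses_kernel p hps
  refine hs.van_one_iff.mpr (qInj_of_van (van_zero_iff.mpr fun x => ?_))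
  choose s hs' using fun A : (subsets.{u} k).obj T => hex A
  -- An additive section of `p` over `T` alone. Each `y - σ (p y)` is a combination of such
  -- differences, and for `y` in the kernel it is `y` itself.
  let σ : (lin (subsets.{u} k)).obj T ⟶ (lin (repr X)).obj T := ModuleCat.ofAddHom
    (Finsupp.liftAddHom fun A => zmultiplesHom ((lin (repr X)).obj T) (single ⟨⟩ (s A)) :
      ((subsets.{u} k).obj T →₀ ℤ) →+ (lin (repr X)).obj T)
  have hσ : ∀ A, σ (basis _ A) = single ⟨⟩ (s A) := fun A =>
    (Finsupp.liftAddHom_apply_single (fun A => zmultiplesHom ((lin (repr X)).obj T)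
      (single ⟨⟩ (s A))) A 1).trans (one_zsmul _)
  let N : Submodule ℤ ((lin (repr X)).obj T) :=
    (decomposables (kernel p).toModule T).map ((kernel p).ι.app T).hom
  have key : ∀ y : (lin (repr X)).obj T, y - σ (p.app T y) ∈ N := by
    refine repr_induction (N := N.comap (LinearMap.id - (p.app T ≫ σ).hom)) fun _ g => ?_
    change single ⟨⟩ g - σ (p.app T (single ⟨⟩ g)) ∈ N
    rw [hp, hσ]
    obtain ⟨A, hA⟩ : ∃ A, (subsets k).map g v = A := ⟨_, rfl⟩
    obtain ⟨A0, hA0⟩ := subsets.exists_incl A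
    have hfac : ∀ g' : X ⟨⟩ ⟶ T, (subsets k).map g' v = A →
        ∃ g0, g' = g0 ≫ FI.incl (A.down.1 : Set T.carrier) := by
      intro g' hg'
      have hmem : ∀ i, (show Fin k ↪ T.carrier from g') i ∈ A.down.1 := fun i => by
        rw [← hg']
        exact Finset.mem_map_of_mem _ (Finset.mem_univ i)
      exact ⟨(⟨fun i => ⟨_, hmem i⟩, fun i j hij =>
        (show Fin k ↪ T.carrier from g').injective (congrArg Subtype.val hij)⟩ :
        Fin k ↪ {x // x ∈ (A.down.1 : Set T.carrier)}), rfl⟩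
    rw [hA]
    obtain ⟨g0, hg0⟩ := hfac g hA
    obtain ⟨g1, hg1⟩ := hfac (s A) (hs' A)
    have hk : p.app _ (single ⟨⟩ g0 - single ⟨⟩ g1) = 0 := by
      rw [map_sub, hp, hp, sub_eq_zero]
      refine congrArg _ (subsets.map_injective (FI.incl _) ?_)
      rw [← (subsets k).map_comp, ← (subsets k).map_comp, ← hg0, ← hg1, hA, hs']
    refine ⟨(kernel p).toModule.map (FI.incl _) ⟨_, hk⟩, map_incl_mem _ (subsets.ne_univ A h.ne) _,
      ?_⟩
    change (lin (repr X)).map (FI.incl _) (single ⟨⟩ g0 - single ⟨⟩ g1) = _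
    rw [map_sub, map_single, map_single, ← hg0, ← hg1]
  obtain ⟨y, hy, hyx⟩ := key ((kernel p).ι.app T x)
  have hx : p.app T ((kernel p).ι.app T x) = 0 := x.2
  rw [hx, map_zero, sub_zero] at hyx
  rwa [← (kernel p).ι_injective T hyx]

end FIModule

/-! ### The incidence map and its cokernel, the extremal example. -/

namespace FIModule

section Coeff

variable {Y : FISet.{u}} {T : FI}

/-- The coefficient of a basis vector. -/
noncomputable def coeff (y : Y.obj T) : (lin Y).obj T →+ ℤ :=
  (Finsupp.applyAddHom y : (Y.obj T →₀ ℤ) →+ ℤ)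

theorem lin_ext {x x' : (lin Y).obj T} (h : ∀ y, coeff y x = coeff y x') : x = x' :=
  Finsupp.ext h

open Classical in
theorem coeff_basis (y z : Y.obj T) : coeff z (basis Y y) = if y = z then 1 else 0 :=
  Finsupp.single_apply

theorem lin_addHom_ext {M : Type*} [AddCommGroup M] {φ ψ : (lin Y).obj T →+ M}
    (h : ∀ y, φ (basis Y y) = ψ (basis Y y)) : φ = ψ :=
  Finsupp.addHom_ext' fun y => AddMonoidHom.ext_int (h y)

end Coeff

open Classical in
/-- The sum of the subsets with `a` elements of a set with `b` elements. -/
noncomputable def sumSubsets {a b : ℕ} {T : FI} (B : (subsets.{u} b).obj T) :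
    (lin (subsets.{u} a)).obj T :=
  (Finsupp.ofSupportFinite (fun A => if A.down.1 ⊆ B.down.1 then 1 else 0) (Set.toFinite _) :
    (subsets.{u} a).obj T →₀ ℤ)

open Classical in
theorem coeff_sumSubsets {a b : ℕ} {T : FI} (A : (subsets.{u} a).obj T)
    (B : (subsets.{u} b).obj T) :
    coeff A (sumSubsets B) = if A.down.1 ⊆ B.down.1 then 1 else 0 := rfl

theorem sumSubsets_map {a b : ℕ} {S T : FI} (f : S ⟶ T) (B : (subsets.{u} b).obj S) :
    (sumSubsets ((subsets b).map f B) : (lin (subsets.{u} a)).obj T) =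
      (lin (subsets a)).map f (sumSubsets B) := by
  classical
  refine lin_ext fun A => ?_
  rw [coeff_sumSubsets]
  let f' : S.carrier ↪ T.carrier := f
  have hB : ((subsets.{u} b).map f B).down.1 = B.down.1.map f' := rfl
  by_cases hA : A ∈ Set.range ((subsets.{u} a).map f)
  · obtain ⟨A0, rfl⟩ := hA
    refine Eq.trans ?_ (Finsupp.mapDomain_apply (subsets.map_injective f) _ A0).symm
    refine Eq.trans ?_ (coeff_sumSubsets A0 B).symm
    have hA : ((subsets.{u} a).map f A0).down.1 = A0.down.1.map f' := rfl
    exact if_congr (by rw [hA, hB, Finset.map_subset_map]) rfl rfl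
  · refine Eq.trans (if_neg fun h => hA ?_) (Finsupp.mapDomain_of_notMem_range _ A hA).symm
    rw [hB, Finset.subset_map_iff] at h
    obtain ⟨U, -, hU⟩ := h
    exact ⟨⟨⟨U, by rw [← Finset.card_map f', ← hU, A.down.2]⟩⟩, subsets.ext hU.symm⟩

/-- The map that sends a set with `b` elements to the sum of its subsets with `a` elements. -/
noncomputable def incidence (a b : ℕ) : lin (subsets.{u} b) ⟶ lin (subsets.{u} a) :=
  linDesc (fun _ B => sumSubsets B) fun f B => sumSubsets_map f B

theorem incidence_basis {a b : ℕ} {T : FI} (B : (subsets.{u} b).obj T) :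
    (incidence a b).app T (basis _ B) = sumSubsets B :=
  linDesc_basis (fun _ B => sumSubsets B) (fun f B => sumSubsets_map f B) B

open Classical in
theorem coeff_incidence {a b : ℕ} {T : FI} [Fintype ((subsets.{u} b).obj T)]
    (A : (subsets.{u} a).obj T) (x : (lin (subsets.{u} b)).obj T) :
    coeff A ((incidence a b).app T x) =
      ∑ B : (subsets.{u} b).obj T, if A.down.1 ⊆ B.down.1 then coeff B x else 0 := by
  have h : (coeff A).comp ((incidence a b).app T).hom.toAddMonoidHom =
      ∑ B : (subsets.{u} b).obj T, if A.down.1 ⊆ B.down.1 then coeff B else 0 := by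
    refine lin_addHom_ext fun B => ?_
    refine Eq.trans (congrArg (coeff A) (incidence_basis B)) ?_
    rw [coeff_sumSubsets, AddMonoidHom.finsetSum_apply,
      Finset.sum_eq_single_of_mem B (Finset.mem_univ B)]
    · split_ifs
      · rw [coeff_basis, if_pos rfl]
      · rfl
    · intro C _ hC
      split_ifs
      · rw [coeff_basis, if_neg (Ne.symm hC)]
      · rfl
  refine (congrArg (fun φ : (lin (subsets.{u} b)).obj T →+ ℤ => φ x) h).trans ?_
  rw [AddMonoidHom.finsetSum_apply]
  refine Finset.sum_congr rfl fun B _ => ?_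
  split_ifs <;> rfl

theorem eq_zero_of_incidence_eq_zero {a b : ℕ} (hab : a ≤ b) {T : FI}
    (hT : Nat.card T.carrier ≤ a + b) (x : (lin (subsets.{u} b)).obj T)
    (hx : (incidence a b).app T x = 0) : x = 0 := by
  classical
  have := Fintype.ofFinite T.carrier
  have := Fintype.ofFinite ((subsets.{u} b).obj T)
  let F : Finset T.carrier → ℤ := fun B =>
    if h : B.card = b then coeff (⟨⟨B, h⟩⟩ : (subsets.{u} b).obj T) x else 0
  have hF : ∀ B : (subsets.{u} b).obj T, F B.down.1 = coeff B x := fun B => dif_pos B.down.2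
  refine lin_ext fun B => ?_
  rw [map_zero, ← hF]
  refine Finset.eq_zero_of_sum_superset_eq_zero hab
    (by rwa [← Nat.card_eq_fintype_card]) F (fun B hB => dif_neg hB) (fun A hA => ?_) _
  have h1 := coeff_incidence (⟨⟨A, hA⟩⟩ : (subsets.{u} a).obj T) x
  rw [hx, map_zero] at h1
  refine (Fintype.sum_of_injective (fun B : (subsets.{u} b).obj T => B.down.1)
    (fun _ _ h => subsets.ext h) _ _ (fun C hC => ?_) (fun B => ?_)).symm.trans h1.symm
  · have : F C = 0 := dif_neg fun h => hC ⟨⟨⟨C, h⟩⟩, rfl⟩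
    rw [this, ite_self]
  · exact if_congr Iff.rfl (hF B).symm rfl

theorem card_subsets_obj (k : ℕ) (T : FI) :
    Nat.card ((subsets.{u} k).obj T) = (Nat.card T.carrier).choose k := by
  have := Fintype.ofFinite T.carrier
  refine (Nat.card_congr Equiv.ulift).trans ?_
  rw [Nat.card_eq_fintype_card, Fintype.card_finset_len, Nat.card_eq_fintype_card]

/-- With `n = a + b + 1`, the source has rank `C(n, b) = C(n, a + 1)`, and `(a + 1) C(n, a + 1) = (b
+ 1) C(n, a)`. So `a < b` makes the rank of the source exceed that of the target. -/
theorem exists_incidence_eq_zero {a b : ℕ} (hab : a < b) {T : FI}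
    (hT : Nat.card T.carrier = a + b + 1) :
    ∃ x : (lin (subsets.{u} b)).obj T, (incidence a b).app T x = 0 ∧ x ≠ 0 := by
  by_contra! h
  have := Fintype.ofFinite ((subsets.{u} a).obj T)
  have := Fintype.ofFinite ((subsets.{u} b).obj T)
  let ψ : ((subsets.{u} b).obj T →₀ ℤ) →+ ((subsets.{u} a).obj T →₀ ℤ) :=
    ((incidence a b).app T).hom.toAddMonoidHom
  have h1 := LinearMap.finrank_le_finrank_of_injective (f := ψ.toIntLinearMap)
    ((injective_iff_map_eq_zero ψ).mpr h)
  rw [Module.finrank_finsupp_self, Module.finrank_finsupp_self, ← Nat.card_eq_fintype_card,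
    ← Nat.card_eq_fintype_card, card_subsets_obj, card_subsets_obj, hT] at h1
  have h2 := Nat.choose_succ_right_eq (a + b + 1) a
  have h3 : (a + b + 1).choose b = (a + b + 1).choose (a + 1) :=
    Nat.choose_symm_of_eq_add (by omega)
  have h4 : 0 < (a + b + 1).choose a := Nat.choose_pos (by omega)
  rw [h3] at h1
  have h5 : a + b + 1 - a = b + 1 := by omega
  rw [h5] at h2
  nlinarith

/-- The cokernel of the incidence map. -/
noncomputable def cokerIncidence (a b : ℕ) : FIModule.{u} := (range (incidence a b)).quot

section CokerIncidence

variable {a b : ℕ} {S : FI}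

theorem van_zero_cokerIncidence (h : a ≠ Nat.card S.carrier) :
    Van 0 (cokerIncidence.{u} a b) S :=
  van_zero_of_surjective _ (range (incidence a b)).π_surjective (van_zero_lin_subsets h)

/-- The incidence map, as a map to its range. -/
noncomputable def toRangeIncidence (a b : ℕ) :
    lin (subsets.{u} b) ⟶ (range (incidence.{u} a b)).toModule :=
  (range (incidence a b)).lift (incidence a b) fun _ x => ⟨x, rfl⟩

theorem toRangeIncidence_surjective (a b : ℕ) (S : FI) :
    Function.Surjective ((toRangeIncidence.{u} a b).app S) := by
  rintro ⟨_, x, rfl⟩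
  exact ⟨x, rfl⟩

theorem van_one_cokerIncidence (hab : a < b) (h : b < Nat.card S.carrier) :
    Van 1 (cokerIncidence.{u} a b) S :=
  (range (incidence a b)).ses.van_right (van_one_lin_subsets (hab.trans h))
    (van_zero_of_surjective _ (toRangeIncidence_surjective a b) (van_zero_lin_subsets h.ne))

/-- In degree `a` there are no `b`-element subsets to divide out, and below `a` the module is zero.
-/
theorem not_van_zero_cokerIncidence (hab : a < b) :
    ¬ Van 0 (cokerIncidence.{u} a b) ⟨Fin a⟩ := by
  intro h
  have hz : ∀ T : FI, Nat.card T.carrier < Nat.card (⟨Fin a⟩ : FI).carrier →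
      ∀ x : (cokerIncidence.{u} a b).obj T, x = 0 := by
    intro T hT x
    obtain ⟨y, rfl⟩ := (range (incidence a b)).π_surjective T x
    rw [lin_subsets_eq_zero (by simpa using hT) y, map_zero]
    rfl
  let v : (subsets.{u} a).obj ⟨Fin a⟩ := ⟨⟨Finset.univ, Finset.card_fin a⟩⟩
  have h1 := decomposables_le_bot hz (van_zero_iff.mp h
    ((range (incidence a b)).π.app ⟨Fin a⟩ (basis (subsets.{u} a) v)))
  obtain ⟨y, hy⟩ := (Sub.π_eq_zero_iff _ _).mp ((Submodule.mem_bot ℤ).mp h1)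
  have hy0 : y = 0 := lin_subsets_eq_zero (by simpa using hab) y
  have h2 : coeff v (basis (subsets.{u} a) v) = 0 := by
    rw [← hy, hy0, map_zero, map_zero]
  classical
  rw [coeff_basis, if_pos rfl] at h2
  exact one_ne_zero h2

/-- The kernel of the incidence map is first nonzero in degree `a + b + 1`, so its `H₀` survives
there. `H₀` of the module of `b`-subsets is zero in that degree, so the class yields `H₁` of the
range and then `H₂` of the cokernel. -/
theorem not_van_two_cokerIncidence (hab : a < b) (hS : Nat.card S.carrier = a + b + 1) :
    ¬ Van 2 (cokerIncidence.{u} a b) S := by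
  intro h
  have h1 : Van 1 (range (incidence.{u} a b)).toModule S :=
    (range (incidence a b)).ses.van_left h (van_one_lin_subsets (by omega))
  have hs : SES (kernel (toRangeIncidence.{u} a b)).ι (toRangeIncidence a b) :=
    ses_kernel _ (toRangeIncidence_surjective a b)
  have hinj := hs.qInj h1
  obtain ⟨x, hx, hx0⟩ := exists_incidence_eq_zero.{u} hab hS
  have hz : ∀ T : FI, Nat.card T.carrier < Nat.card S.carrier →
      ∀ y : (kernel (toRangeIncidence.{u} a b)).toModule.obj T, y = 0 := by
    rintro T hT ⟨y, hy⟩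
    exact Subtype.ext (eq_zero_of_incidence_eq_zero hab.le (by omega) y (congrArg Subtype.val hy))
  let k : (kernel (toRangeIncidence.{u} a b)).toModule.obj S := ⟨x, Subtype.ext hx⟩
  have h2 := decomposables_le_bot hz
    (hinj k (van_zero_iff.mp (van_zero_lin_subsets (by omega)) _))
  have h3 : k = 0 := (Submodule.mem_bot ℤ).mp h2
  exact hx0 (congrArg Subtype.val h3)

/-- This secures `0 ≤ t₁`: if `H₁` were zero, `H₂` would be too. -/
theorem exists_not_van_one_cokerIncidence (hab : a < b) :
    ∃ S, ¬ Van 1 (cokerIncidence.{u} a b) S := by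
  by_contra! h
  exact not_van_two_cokerIncidence hab (by simp)
    (van_of_forall_van_one (a + 1) (fun S hS => van_zero_cokerIncidence (by omega)) h 1
      ⟨Fin (a + b + 1)⟩)

end CokerIncidence

end FIModule

/-! ### From vanishing to `t` and `reg`. -/

namespace FIModule

variable {V : FIModule.{u}}

theorem t_le {i : ℕ} {d : ℤ} (hd : -1 ≤ d)
    (h : ∀ S : FI, d < (Nat.card S.carrier : ℤ) → Van i V S) : t i V ≤ ((d : ℝ) : EReal) :=
  sInf_le ⟨d, rfl, hd, fun S hS => h ⟨S.carrier⟩ hS⟩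

theorem le_t {i : ℕ} {S : FI} (h : ¬ Van i V S) : (Nat.card S.carrier : EReal) ≤ t i V := by
  refine le_sInf ?_
  rintro _ ⟨d, rfl, -, hd⟩
  have h1 : (Nat.card S.carrier : ℤ) ≤ d := not_lt.mp fun h2 => h (hd ⟨S.carrier⟩ h2)
  exact_mod_cast h1

theorem t_nonneg {i : ℕ} {S : FI} (h : ¬ Van i V S) : 0 ≤ t i V :=
  le_trans (by exact_mod_cast Nat.zero_le _) (le_t h)

theorem neg_one_le_t (i : ℕ) (V : FIModule.{u}) : (((-1 : ℤ) : ℝ) : EReal) ≤ t i V := by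
  refine le_sInf ?_
  rintro _ ⟨d, rfl, hd, -⟩
  exact EReal.coe_le_coe_iff.mpr (Int.cast_le.mpr hd)

theorem t_le_natCast_iff {i n : ℕ} :
    t i V ≤ (n : EReal) ↔ ∀ S : FI, n + 1 ≤ Nat.card S.carrier → Van i V S := by
  constructor
  · intro h S hS
    by_contra hv
    have h1 : Nat.card S.carrier ≤ n := by exact_mod_cast (le_t hv).trans h
    omega
  · intro h
    exact_mod_cast t_le (d := n) (by omega) fun S hS => h S (by omega)

theorem reg_le {r : ℤ} (hr : -2 ≤ r)
    (h : ∀ (i : ℕ) (S : FI), r + (i + 1) < (Nat.card S.carrier : ℤ) → Van (i + 1) V S) :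
    reg V ≤ ((r : ℝ) : EReal) := by
  refine iSup₂_le fun i hi => EReal.sub_le_of_le_add ?_
  obtain ⟨i, rfl⟩ := Nat.exists_eq_add_of_le' hi
  exact_mod_cast t_le (d := r + (i + 1)) (by omega) fun S hS => h i S hS

theorem le_reg {i : ℕ} (hi : 1 ≤ i) {r : ℤ} (h : (((r + i : ℤ) : ℝ) : EReal) ≤ t i V) :
    ((r : ℝ) : EReal) ≤ reg V := by
  refine le_trans ?_ (le_iSup₂ (f := fun (i : ℕ) (_ : 1 ≤ i) => t i V - ((i : ℝ) : EReal)) i hi)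
  refine (EReal.le_sub_iff_add_le (Or.inl (EReal.coe_ne_bot _))
    (Or.inl (EReal.coe_ne_top _))).mpr ?_
  rwa [← EReal.coe_add, ← Int.cast_natCast, ← Int.cast_add]

theorem reg_le_of_lt {a b : ℕ} (hab : a < b) (h0 : t 0 V ≤ (a : EReal))
    (h1 : t 1 V ≤ (b : EReal)) : reg V ≤ (((a + b - 1 : ℤ) : ℝ) : EReal) :=
  -- `van_bound` uses strict bounds on degrees, hence `a + 1` and `b + 1`.
  reg_le (by omega) fun _ _ hS => van_bound (a + 1) (b := b + 1) (by omega)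
    (t_le_natCast_iff.mp h0) (t_le_natCast_iff.mp h1) (by omega)

theorem reg_le_of_relations {a b : ℕ} (h0 : t 0 V ≤ (a : EReal))
    (h1 : t 1 V ≤ (b : EReal)) : reg V ≤ (((2 * b - 2 : ℤ) : ℝ) : EReal) :=
  reg_le (by omega) fun _ _ hS => van_bound_of_relations
    (t_le_natCast_iff.mp h0) (t_le_natCast_iff.mp h1) (by omega)

section CokerIncidence

variable {a b : ℕ}

theorem t_zero_cokerIncidence_nonneg (hab : a < b) : 0 ≤ t 0 (cokerIncidence.{u} a b) :=
  t_nonneg (not_van_zero_cokerIncidence hab)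

theorem t_zero_cokerIncidence_le (a b : ℕ) : t 0 (cokerIncidence.{u} a b) ≤ (a : EReal) :=
  t_le_natCast_iff.mpr fun _ hS => van_zero_cokerIncidence (by omega)

theorem t_one_cokerIncidence_nonneg (hab : a < b) : 0 ≤ t 1 (cokerIncidence.{u} a b) := by
  obtain ⟨S, hS⟩ := exists_not_van_one_cokerIncidence.{u} hab
  exact t_nonneg hS

theorem t_one_cokerIncidence_le (hab : a < b) : t 1 (cokerIncidence.{u} a b) ≤ (b : EReal) :=
  t_le_natCast_iff.mpr fun _ hS => van_one_cokerIncidence hab hS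

theorem reg_cokerIncidence (hab : a < b) :
    reg (cokerIncidence.{u} a b) = (((a + b - 1 : ℤ) : ℝ) : EReal) := by
  refine le_antisymm (reg_le_of_lt hab (t_zero_cokerIncidence_le a b)
    -- The bound is attained at `H₂`, in degree `a + b + 1`.
    (t_one_cokerIncidence_le hab)) (le_reg (i := 2) (by omega) ?_)
  have h := le_t (not_van_two_cokerIncidence.{u} (S := ⟨Fin (a + b + 1)⟩) hab (by simp))
  rw [Nat.card_fin] at h
  refine le_trans (le_of_eq ?_) h
  have : (a + b - 1 + (2 : ℕ) : ℤ) = ((a + b + 1 : ℕ) : ℤ) := by push_cast; ring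
  rw [this]
  norm_cast

end CokerIncidence

theorem van_zero_free {S T : FI} (h : Nat.card S.carrier < Nat.card T.carrier) :
    Van 0 (free.{u} S) T := by
  have key : ∀ x : (S ⟶ T) →₀ ULift.{u} ℤ,
      (show (free.{u} S).obj T from x) ∈ decomposables (free.{u} S) T := by
    intro x
    induction x using Finsupp.induction_linear with
    | zero => exact Submodule.zero_mem _
    | add x y hx hy => exact Submodule.add_mem _ hx hy
    | single g c =>
      rw [single_eq_smul_map_gen]
      refine zsmul_mem (map_mem_decomposables _ g (fun hg => ?_) _) _
      exact h.not_ge (Nat.card_le_card_of_surjective _ hg)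
  exact van_zero_iff.mpr key

theorem not_van_zero_free {S : FI} (h : Nat.card S.carrier = 0) : ¬ Van 0 (free.{u} S) S := by
  intro hv
  have h1 := decomposables_le_bot (fun T hT => by omega) (van_zero_iff.mp hv (gen S))
  have h2 : (Finsupp.single (𝟙 S) ⟨1⟩ : (S ⟶ S) →₀ ULift.{u} ℤ) = 0 := (Submodule.mem_bot ℤ).mp h1
  exact one_ne_zero (congrArg ULift.down (Finsupp.single_eq_zero.mp h2))

theorem t_free_le (i : ℕ) (S : FI) : t (i + 1) (free.{u} S) ≤ (((-1 : ℤ) : ℝ) : EReal) :=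
  t_le le_rfl fun T _ => van_of_projective (free.{u} S) i T

theorem reg_free (S : FI) : reg (free.{u} S) = ((((-2 : ℤ) : ℝ)) : EReal) :=
  le_antisymm (reg_le le_rfl fun i T _ => van_of_projective _ i T)
    -- The zero module has degree `-1`, so already `t₁ - 1 = -2`.
    (le_reg (i := 1) le_rfl (neg_one_le_t 1 (free.{u} S)))

end FIModule

theorem mainTheorem1 (a b : ℕ) :
    (1 ≤ b → IsGreatest
      {r : EReal | ∃ V : FIModule.{u},
        (0 ≤ FIModule.t 0 V ∧ FIModule.t 0 V ≤ (a : EReal)) ∧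
        (0 ≤ FIModule.t 1 V ∧ FIModule.t 1 V ≤ (b : EReal)) ∧
        FIModule.reg V = r}
      (if a < b then (a : EReal) + (b : EReal) - 1 else 2 * (b : EReal) - 2)) ∧
    (b = 0 → IsGreatest
      {r : EReal | ∃ V : FIModule.{u},
        (0 ≤ FIModule.t 0 V ∧ FIModule.t 0 V ≤ (a : EReal)) ∧
        FIModule.t 1 V ≤ (b : EReal) ∧
        FIModule.reg V = r}
      (2 * (b : EReal) - 2)) := by
  have hr : (((2 * b - 2 : ℤ) : ℝ) : EReal) = 2 * (b : EReal) - 2 := by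
    push_cast
    rfl
  refine ⟨fun hb => ?_, fun hb => ?_⟩
  · split_ifs with hab
    · have hab' : (((a + b - 1 : ℤ) : ℝ) : EReal) = (a : EReal) + (b : EReal) - 1 := by
        push_cast
        rfl
      rw [← hab']
      refine ⟨⟨FIModule.cokerIncidence a b, ⟨FIModule.t_zero_cokerIncidence_nonneg hab,
        FIModule.t_zero_cokerIncidence_le a b⟩, ⟨FIModule.t_one_cokerIncidence_nonneg hab,
        FIModule.t_one_cokerIncidence_le hab⟩, FIModule.reg_cokerIncidence hab⟩, ?_⟩
      rintro _ ⟨V, ⟨-, h0⟩, ⟨-, h1⟩, rfl⟩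
      exact FIModule.reg_le_of_lt hab h0 h1
    · rw [← hr]
      have hb1 : b - 1 < b := by omega
      -- The pair `(b - 1, b)` is admissible because `b - 1 ≤ a`, and its regularity is `(b - 1) + b
      -- - 1 = 2b - 2`.
      refine ⟨⟨FIModule.cokerIncidence (b - 1) b, ⟨FIModule.t_zero_cokerIncidence_nonneg hb1,
        (FIModule.t_zero_cokerIncidence_le (b - 1) b).trans ?_⟩,
        ⟨FIModule.t_one_cokerIncidence_nonneg hb1, FIModule.t_one_cokerIncidence_le hb1⟩, ?_⟩, ?_⟩
      · exact_mod_cast (by omega : b - 1 ≤ a)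
      · rw [FIModule.reg_cokerIncidence hb1]
        have : ((b - 1 : ℕ) + b - 1 : ℤ) = 2 * b - 2 := by omega
        rw [this]
      · rintro _ ⟨V, ⟨-, h0⟩, ⟨-, h1⟩, rfl⟩
        exact FIModule.reg_le_of_relations h0 h1
  · rw [← hr]
    have hS : Nat.card (⟨Fin 0⟩ : FI).carrier = 0 := by simp
    -- The free module on the empty set is generated in degree `0`, so it is admissible for every
    -- `a`.
    refine ⟨⟨FIModule.free ⟨Fin 0⟩, ⟨FIModule.t_nonneg (FIModule.not_van_zero_free hS),
      FIModule.t_le_natCast_iff.mpr fun T hT => FIModule.van_zero_free (by omega)⟩,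
      (FIModule.t_free_le 0 _).trans ?_, ?_⟩, ?_⟩
    · exact EReal.coe_le_coe_iff.mpr (by push_cast; linarith [Nat.cast_nonneg (α := ℝ) b])
    · rw [FIModule.reg_free, hb]
      norm_num
    · rintro _ ⟨V, ⟨-, h0⟩, h1, rfl⟩
      exact FIModule.reg_le_of_relations h0 h1
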